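/- Let $k$ be a field. A $k$-quiver $\mathcal A$ consists of a set of objects $\mathrm{Ob}\,\mathcal A$ and of a $k$-module $\mathcal A(X,Y)$ for each pair of objects; a morphism $f:\mathcal A\to\mathcal B$ consists of a map $f:\mathrm{Ob}\,\mathcal A\to\mathrm{Ob}\,\mathcal B$ and of $k$-linear maps $\mathcal A(X,Y)\to\mathcal B(f(X),f(Y))$. For quivers with the same object set $S$, put $(\mathcal A\otimes\mathcal B)(X,Z)=\bigoplus_{Y\in S}\mathcal A(X,Y)\otimes_k\mathcal B(Y,Z)$. A cocategory is a quiver $\mathcal C$ with a coassociative (not necessarily counital) comultiplication $\Delta:\mathcal C\to\mathcal C\otimes\mathcal C$ which is a morphism of quivers over the identity of $\mathrm{Ob}\,\mathcal C$; a cocategory homomorphism is a morphism of quivers $f$ with $\Delta f=(f\otimes f)\Delta$. Let $\Delta^{(1)}=\mathrm{id}$ and $\Delta^{(n+1)}=(1\otimes\Delta^{(n)})\Delta:\mathcal C\to\mathcal C^{\otimes (n+1)}$. The cocategory $\mathcal C$ is cocomplete if $\mathcal C(X,Y)=\bigcup_{n\ge1}\ker\Delta^{(n)}$ for all objects $X,Y$.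 Graded (resp. differential graded) cocategories are defined in the same way with $\mathbb Z$-graded $k$-modules and maps of degree $0$ (resp. cochain complexes of $k$-modules and cochain maps, tensor products of complexes being taken with the Koszul sign). For a set $S$, let $kS$ be the quiver with object set $S$, $kS(X,X)=k$ and $kS(X,Y)=0$ for $X\ne Y$ (placed in degree $0$, with zero differential, in the graded settings), which is the unit for $\otimes$ and carries the comultiplication $kS\cong kS\otimes kS$ and the counit $\mathrm{id}$. An augmented cocategory is a cocategory $\mathcal C$ with a counit $\varepsilon:\mathcal C\to k\,\mathrm{Ob}\,\mathcal C$ and a morphism of counital cocategories $\eta:k\,\mathrm{Ob}\,\mathcal C\to\mathcal C$, both over the identity of $\mathrm{Ob}\,\mathcal C$, such that $\varepsilon\eta=\mathrm{id}$; morphisms are the cocategory homomorphisms compatible with $\varepsilon$ and $\eta$. Its reduction is the quiver $\ker\varepsilon$ with the comultiplication $((1-\eta\varepsilon)\otimes(1-\eta\varepsilon))\circ\Delta|_{\ker\varepsilon}$, and $\mathcal C$ is called cocomplete if the cocategory $\ker\varepsilon$ is cocomplete. Theorem. The category of cocomplete $k$-cocategories (a full subcategory of the category of $k$-cocategories) has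 equalizers. The same holds for the category of cocomplete graded $k$-cocategories and for the category of cocomplete differential graded $k$-cocategories. Likewise, the categories of cocomplete augmented, cocomplete graded augmented and cocomplete differential graded augmented $k$-cocategories have equalizers. -/

import Mathlib

set_option linter.checkUnivs false

open CategoryTheory CategoryTheory.Limits
open scoped TensorProduct DirectSum

universe u v w w' v₁ v₂ w₁ w₂ w₃ w₄ w₅ w₆

namespace Cocat

noncomputable section

/-! ### Quivers and their tensor products -/

/-- A `k`-quiver: a set of objects and a `k`-module `Hom X Y` for each pair of objects. -/
structure KQuiver (k : Type u) [CommRing k] where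
  Ob : Type v
  Hom : Ob → Ob → ModuleCat.{w} k

section Tensor

variable {k : Type u} [CommRing k]

/-- The tensor product of two quivers with the same set of objects `S`:
`(A ⊗ B)(X, Z) = ⨁_Y A(X, Y) ⊗ B(Y, Z)`. -/
abbrev TensorHom {S : Type v} (A : S → S → ModuleCat.{w} k) (B : S → S → ModuleCat.{w'} k)
    (X Z : S) : Type (max v w w') :=
  ⨁ Y : S, (A X Y ⊗[k] B Y Z)

open Classical in
/-- The inclusion of the summand `A(X, Y) ⊗ B(Y, Z)` into `(A ⊗ B)(X, Z)`. -/
def tensorIncl {S : Type v} (A : S → S → ModuleCat.{w} k) (B : S → S → ModuleCat.{w'} k)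
    (X Y Z : S) : A X Y ⊗[k] B Y Z →ₗ[k] TensorHom A B X Z :=
  DirectSum.lof k S (fun Y => A X Y ⊗[k] B Y Z) Y

/-- The projection of `(A ⊗ B)(X, Z)` onto the summand `A(X, Y) ⊗ B(Y, Z)`. -/
def tensorProj {S : Type v} (A : S → S → ModuleCat.{w} k) (B : S → S → ModuleCat.{w'} k)
    (X Y Z : S) : TensorHom A B X Z →ₗ[k] A X Y ⊗[k] B Y Z :=
  DirectSum.component k S (fun Y => A X Y ⊗[k] B Y Z) Y

open Classical in
/-- The map `f ⊗ g` induced on tensor products of quivers by two families of linear maps `f`, `g`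
lying over the same map of objects `φ`: the summand `A(X, Y) ⊗ B(Y, Z)` is sent by
`f_{X,Y} ⊗ g_{Y,Z}` to the summand of index `φ Y`. -/
def tensorMap {S : Type v₁} {T : Type v₂}
    {A : S → S → ModuleCat.{w₁} k} {B : S → S → ModuleCat.{w₂} k}
    {A' : T → T → ModuleCat.{w₃} k} {B' : T → T → ModuleCat.{w₄} k} (φ : S → T)
    (f : ∀ X Y, A X Y →ₗ[k] A' (φ X) (φ Y)) (g : ∀ X Y, B X Y →ₗ[k] B' (φ X) (φ Y)) (X Z : S) :
    TensorHom A B X Z →ₗ[k] TensorHom A' B' (φ X) (φ Z) :=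
  DirectSum.toModule k S _ fun Y =>
    tensorIncl A' B' (φ X) (φ Y) (φ Z) ∘ₗ TensorProduct.map (f X Y) (g Y Z)

lemma tensorMap_incl {S : Type v₁} {T : Type v₂}
    {A : S → S → ModuleCat.{w₁} k} {B : S → S → ModuleCat.{w₂} k}
    {A' : T → T → ModuleCat.{w₃} k} {B' : T → T → ModuleCat.{w₄} k} (φ : S → T)
    (f : ∀ X Y, A X Y →ₗ[k] A' (φ X) (φ Y)) (g : ∀ X Y, B X Y →ₗ[k] B' (φ X) (φ Y)) (X Y Z : S)
    (t : A X Y ⊗[k] B Y Z) :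
    tensorMap φ f g X Z (tensorIncl A B X Y Z t) =
      tensorIncl A' B' (φ X) (φ Y) (φ Z) (TensorProduct.map (f X Y) (g Y Z) t) := by
  simp [tensorMap, tensorIncl, DirectSum.toModule_lof]

lemma tensorHom_ext {S : Type v} {A : S → S → ModuleCat.{w} k} {B : S → S → ModuleCat.{w'} k}
    {X Z : S} {M : Type*} [AddCommGroup M] [Module k M] {p q : TensorHom A B X Z →ₗ[k] M}
    (h : ∀ Y t, p (tensorIncl A B X Y Z t) = q (tensorIncl A B X Y Z t)) : p = q := by
  classical
  refine DirectSum.linearMap_ext _ fun Y => LinearMap.ext fun t => ?_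
  simpa [tensorIncl] using h Y t

lemma tensorMap_id {S : Type v} {A : S → S → ModuleCat.{w} k} {B : S → S → ModuleCat.{w'} k}
    (X Z : S) :
    tensorMap (A := A) (B := B) (A' := A) (B' := B) (fun X => X)
      (fun _ _ => LinearMap.id) (fun _ _ => LinearMap.id) X Z = LinearMap.id :=
  tensorHom_ext fun Y t => by simp [tensorMap_incl]

lemma tensorMap_comp {S : Type v₁} {T : Type v₂} {U : Type v}
    {A : S → S → ModuleCat.{w₁} k} {B : S → S → ModuleCat.{w₂} k}
    {A' : T → T → ModuleCat.{w₃} k} {B' : T → T → ModuleCat.{w₄} k}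
    {A'' : U → U → ModuleCat.{w₅} k} {B'' : U → U → ModuleCat.{w₆} k}
    (φ : S → T) (ψ : T → U) (f : ∀ X Y, A X Y →ₗ[k] A' (φ X) (φ Y))
    (g : ∀ X Y, B X Y →ₗ[k] B' (φ X) (φ Y))
    (f' : ∀ X Y, A' X Y →ₗ[k] A'' (ψ X) (ψ Y))
    (g' : ∀ X Y, B' X Y →ₗ[k] B'' (ψ X) (ψ Y)) (X Z : S) :
    tensorMap (fun X => ψ (φ X)) (fun X Y => f' (φ X) (φ Y) ∘ₗ f X Y)
        (fun X Y => g' (φ X) (φ Y) ∘ₗ g X Y) X Z =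
      tensorMap ψ f' g' (φ X) (φ Z) ∘ₗ tensorMap φ f g X Z :=
  tensorHom_ext fun Y t => by
    rw [LinearMap.comp_apply, tensorMap_incl, tensorMap_incl, tensorMap_incl,
      TensorProduct.map_comp, LinearMap.comp_apply]

lemma tensorProj_comp_tensorMap {S : Type v}
    {A : S → S → ModuleCat.{w₁} k} {B : S → S → ModuleCat.{w₂} k}
    {A' : S → S → ModuleCat.{w₃} k} {B' : S → S → ModuleCat.{w₄} k}
    (f : ∀ X Y, A X Y →ₗ[k] A' X Y) (g : ∀ X Y, B X Y →ₗ[k] B' X Y) (X Y Z : S) :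
    tensorProj A' B' X Y Z ∘ₗ tensorMap (fun X => X) f g X Z =
      TensorProduct.map (f X Y) (g Y Z) ∘ₗ tensorProj A B X Y Z :=
  tensorHom_ext fun Y' t => by
    rw [LinearMap.comp_apply, tensorMap_incl, LinearMap.comp_apply]
    by_cases h : Y' = Y
    · subst h
      simp [tensorProj, tensorIncl, DirectSum.component.lof_self]
    · simp [tensorProj, tensorIncl, DirectSum.component.of, h]

end Tensor

/-! ### Cocategories -/

/-- A cocategory: a quiver with a coassociative comultiplication over the identity of the set of
objects. Coassociativity is expressed on the components
`Δ_{X,Y,Z} : C(X, Z) → C(X, Y) ⊗ C(Y, Z)`. No counit is required. -/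
structure Cocategory (k : Type u) [CommRing k] extends KQuiver.{u, v, w} k where
  Δ : ∀ X Z : Ob, Hom X Z →ₗ[k] TensorHom Hom Hom X Z
  coassoc : ∀ W X Y Z : Ob,
    (TensorProduct.assoc k (Hom W X) (Hom X Y) (Hom Y Z)).toLinearMap ∘ₗ
        LinearMap.rTensor (Hom Y Z) (tensorProj Hom Hom W X Y ∘ₗ Δ W Y) ∘ₗ
          (tensorProj Hom Hom W Y Z ∘ₗ Δ W Z) =
      LinearMap.lTensor (Hom W X) (tensorProj Hom Hom X Y Z ∘ₗ Δ X Z) ∘ₗ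
        (tensorProj Hom Hom W X Z ∘ₗ Δ W Z)

/-- The component `Δ_{X,Y,Z} : C(X, Z) → C(X, Y) ⊗ C(Y, Z)` of the comultiplication. -/
def Cocategory.comp {k : Type u} [CommRing k] (C : Cocategory.{u, v, w} k) (X Y Z : C.Ob) :
    C.Hom X Z →ₗ[k] C.Hom X Y ⊗[k] C.Hom Y Z :=
  tensorProj C.Hom C.Hom X Y Z ∘ₗ C.Δ X Z

/-- A morphism of quivers: a map of objects and compatible linear maps. -/
structure KQuiver.Mor {k : Type u} [CommRing k] (A B : KQuiver.{u, v, w} k) where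
  obj : A.Ob → B.Ob
  map : ∀ X Y, A.Hom X Y →ₗ[k] B.Hom (obj X) (obj Y)

/-- A cocategory homomorphism: a morphism of quivers with `Δ ∘ f = (f ⊗ f) ∘ Δ`. -/
structure Cocategory.Mor {k : Type u} [CommRing k] (C D : Cocategory.{u, v, w} k) extends
    toQMor : KQuiver.Mor C.toKQuiver D.toKQuiver where
  comm : ∀ X Z, D.Δ (obj X) (obj Z) ∘ₗ map X Z = tensorMap obj map map X Z ∘ₗ C.Δ X Z

variable {k : Type u} [CommRing k]

def Cocategory.Mor.id (C : Cocategory.{u, v, w} k) : C.Mor C where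
  obj X := X
  map _ _ := LinearMap.id
  comm X Z := by rw [tensorMap_id]; rfl

def Cocategory.Mor.comp {C D E : Cocategory.{u, v, w} k} (f : C.Mor D) (g : D.Mor E) :
    C.Mor E where
  obj X := g.obj (f.obj X)
  map X Y := g.map (f.obj X) (f.obj Y) ∘ₗ f.map X Y
  comm X Z := by
    rw [tensorMap_comp, ← LinearMap.comp_assoc, g.comm, LinearMap.comp_assoc, f.comm,
      LinearMap.comp_assoc]

/-- The category of cocategories. -/
instance : Category (Cocategory.{u, v, w} k) where
  Hom C D := C.Mor D
  id C := Cocategory.Mor.id C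
  comp f g := f.comp g

/-! ### Cocompleteness -/

/-- For a list `Z₁, …, Z_m` of objects, the module
`A(X, Z₁) ⊗ A(Z₁, Z₂) ⊗ ⋯ ⊗ A(Z_m, Y)` (bracketed to the right). -/
def pathHom {S : Type v} (A : S → S → ModuleCat.{w} k) : S → List S → S → ModuleCat.{w} k
  | X, [], Y => A X Y
  | X, Z :: l, Y => ModuleCat.of k (A X Z ⊗[k] pathHom A Z l Y)

/-- The component `Δ^{(m+1)}_{X,Z₁,…,Z_m,Y}` of the iterated comultiplication, where
`Δ^{(1)} = id` and `Δ^{(n+1)} = (1 ⊗ Δ^{(n)}) ∘ Δ`. -/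
def Cocategory.iterComul (C : Cocategory.{u, v, w} k) :
    ∀ (X : C.Ob) (l : List C.Ob) (Y : C.Ob), C.Hom X Y →ₗ[k] pathHom C.Hom X l Y
  | _, [], _ => LinearMap.id
  | X, Z :: l, Y => LinearMap.lTensor (C.Hom X Z) (C.iterComul Z l Y) ∘ₗ C.comp X Z Y

/-- A cocategory is cocomplete if each `t ∈ C(X, Y)` is killed by some iterated comultiplication
`Δ^{(n)}`, `n ≥ 1`, that is, by all the components `Δ^{(n)}_{X,Z₁,…,Z_{n-1},Y}`. -/
def Cocategory.IsCocomplete (C : Cocategory.{u, v, w} k) : Prop :=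
  ∀ (X Y : C.Ob) (t : C.Hom X Y), ∃ n : ℕ, 1 ≤ n ∧
    ∀ l : List C.Ob, l.length + 1 = n → C.iterComul X l Y t = 0

/-- The category of cocomplete cocategories: a full subcategory of the category of cocategories. -/
abbrev CocompleteCocategory (k : Type u) [CommRing k] :=
  ObjectProperty.FullSubcategory fun C : Cocategory.{u, v, w} k => C.IsCocomplete

/-! ### Graded cocategories -/

/-- The part of degree `n` of the tensor product of two graded modules:
the sum of the images of `A^p ⊗ B^q`, `p + q = n`. -/
def tensorDeg {M : Type w} {N : Type w'} [AddCommGroup M] [Module k M] [AddCommGroup N]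
    [Module k N] (A : ℤ → Submodule k M) (B : ℤ → Submodule k N) (n : ℤ) :
    Submodule k (M ⊗[k] N) :=
  ⨆ (p : ℤ) (q : ℤ) (_ : p + q = n), Submodule.map₂ (TensorProduct.mk k M N) (A p) (B q)

/-- A graded cocategory: each `C(X, Y)` is a `ℤ`-graded module, the direct sum of its
homogeneous parts `deg X Y n`, and the comultiplication is of degree `0`. -/
structure GrCocategory (k : Type u) [CommRing k] extends Cocategory.{u, v, w} k where
  deg : ∀ X Y : Ob, ℤ → Submodule k (Hom X Y)
  isInternal : ∀ X Y, DirectSum.IsInternal (deg X Y)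
  Δ_deg : ∀ (X Y Z : Ob) (n : ℤ), ∀ t ∈ deg X Z n,
    tensorProj Hom Hom X Y Z (Δ X Z t) ∈ tensorDeg (deg X Y) (deg Y Z) n

/-- A homomorphism of graded cocategories: a cocategory homomorphism of degree `0`. -/
structure GrCocategory.Mor (C D : GrCocategory.{u, v, w} k) extends
    toCMor : Cocategory.Mor C.toCocategory D.toCocategory where
  map_deg : ∀ X Y n, ∀ t ∈ C.deg X Y n, map X Y t ∈ D.deg (obj X) (obj Y) n

def GrCocategory.Mor.id (C : GrCocategory.{u, v, w} k) : C.Mor C where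
  toCMor := Cocategory.Mor.id C.toCocategory
  map_deg _ _ _ _ ht := ht

def GrCocategory.Mor.comp {C D E : GrCocategory.{u, v, w} k} (f : C.Mor D) (g : D.Mor E) :
    C.Mor E where
  toCMor := f.toCMor.comp g.toCMor
  map_deg _ _ _ _ ht := g.map_deg _ _ _ _ (f.map_deg _ _ _ _ ht)

/-- The category of graded cocategories. -/
instance : Category (GrCocategory.{u, v, w} k) where
  Hom C D := C.Mor D
  id C := GrCocategory.Mor.id C
  comp f g := f.comp g

/-- The category of cocomplete graded cocategories. -/
abbrev CocompleteGrCocategory (k : Type u) [CommRing k] :=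
  ObjectProperty.FullSubcategory fun C : GrCocategory.{u, v, w} k => C.toCocategory.IsCocomplete

/-! ### Differential graded cocategories -/

lemma bijective_coeLinearMap {M : Type w} [AddCommGroup M] [Module k M] {A : ℤ → Submodule k M}
    (hA : DirectSum.IsInternal A) : Function.Bijective (DirectSum.coeLinearMap A) := hA

/-- The sign involution of a graded module: multiplication by `(-1)^n` in degree `n`. -/
def gradedSign {M : Type w} [AddCommGroup M] [Module k M] (A : ℤ → Submodule k M)
    (hA : DirectSum.IsInternal A) : M →ₗ[k] M :=
  DirectSum.toModule k ℤ M (fun n => (n.negOnePow : ℤ) • (A n).subtype) ∘ₗ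
    (LinearEquiv.ofBijective (DirectSum.coeLinearMap A) (bijective_coeLinearMap hA)).symm.toLinearMap

lemma gradedSign_apply {M : Type w} [AddCommGroup M] [Module k M] (A : ℤ → Submodule k M)
    (hA : DirectSum.IsInternal A) {n : ℤ} {t : M} (ht : t ∈ A n) :
    gradedSign A hA t = (n.negOnePow : ℤ) • t := by
  have h : (LinearEquiv.ofBijective (DirectSum.coeLinearMap A) (bijective_coeLinearMap hA)).symm t =
      DirectSum.lof k ℤ (fun n => A n) n ⟨t, ht⟩ := by
    rw [LinearEquiv.symm_apply_eq]
    simp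
  simp [gradedSign, h, DirectSum.toModule_lof]

/-- The differential of the tensor product of two complexes, `d ⊗ 1 + 1 ⊗ d` with the Koszul sign
rule: `a ⊗ b ↦ d a ⊗ b + (-1)^n a ⊗ d b` for `a` of degree `n`. -/
def tensorDiff {M : Type w} {N : Type w'} [AddCommGroup M] [Module k M] [AddCommGroup N]
    [Module k N] (A : ℤ → Submodule k M) (hA : DirectSum.IsInternal A) (dM : M →ₗ[k] M)
    (dN : N →ₗ[k] N) : M ⊗[k] N →ₗ[k] M ⊗[k] N :=
  TensorProduct.map dM LinearMap.id + TensorProduct.map (gradedSign A hA) dN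

/-- A differential graded cocategory: each `C(X, Y)` is a cochain complex (a graded module with a
differential of degree `1` and square zero) and the comultiplication is a cochain map. -/
structure DGCocategory (k : Type u) [CommRing k] extends GrCocategory.{u, v, w} k where
  d : ∀ X Y : Ob, Hom X Y →ₗ[k] Hom X Y
  d_deg : ∀ X Y n, ∀ t ∈ deg X Y n, d X Y t ∈ deg X Y (n + 1)
  d_d : ∀ X Y, d X Y ∘ₗ d X Y = 0
  Δ_d : ∀ X Y Z, (tensorProj Hom Hom X Y Z ∘ₗ Δ X Z) ∘ₗ d X Z =
    tensorDiff (deg X Y) (isInternal X Y) (d X Y) (d Y Z) ∘ₗ (tensorProj Hom Hom X Y Z ∘ₗ Δ X Z)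

/-- A homomorphism of differential graded cocategories: a homomorphism of graded cocategories
whose components are cochain maps. -/
structure DGCocategory.Mor (C D : DGCocategory.{u, v, w} k) extends
    toGrMor : GrCocategory.Mor C.toGrCocategory D.toGrCocategory where
  map_d : ∀ X Y, D.d (obj X) (obj Y) ∘ₗ map X Y = map X Y ∘ₗ C.d X Y

def DGCocategory.Mor.id (C : DGCocategory.{u, v, w} k) : C.Mor C where
  toGrMor := GrCocategory.Mor.id C.toGrCocategory
  map_d _ _ := rfl

def DGCocategory.Mor.comp {C D E : DGCocategory.{u, v, w} k} (f : C.Mor D) (g : D.Mor E) :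
    C.Mor E where
  toGrMor := f.toGrMor.comp g.toGrMor
  map_d X Y := by
    change E.d _ _ ∘ₗ (g.map _ _ ∘ₗ f.map X Y) = (g.map _ _ ∘ₗ f.map X Y) ∘ₗ C.d X Y
    rw [← LinearMap.comp_assoc, g.map_d, LinearMap.comp_assoc, f.map_d, LinearMap.comp_assoc]

/-- The category of differential graded cocategories. -/
instance : Category (DGCocategory.{u, v, w} k) where
  Hom C D := C.Mor D
  id C := DGCocategory.Mor.id C
  comp f g := f.comp g

/-- The category of cocomplete differential graded cocategories. -/
abbrev CocompleteDGCocategory (k : Type u) [CommRing k] :=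
  ObjectProperty.FullSubcategory fun C : DGCocategory.{u, v, w} k => C.toCocategory.IsCocomplete

/-! ### Augmented cocategories -/

/-- The discrete quiver `kS`: `kS(X, X) = k` and `kS(X, Y) = 0` if `X ≠ Y`, realised as a
submodule of `k`. -/
def discHom (k : Type u) [CommRing k] {S : Type v} (X Y : S) : ModuleCat.{u} k :=
  ModuleCat.of k ({ carrier := {c : k | X ≠ Y → c = 0}
                    add_mem' := fun ha hb h => by rw [ha h, hb h, add_zero]
                    zero_mem' := fun _ => rfl
                    smul_mem' := fun r c hc h => by rw [hc h, smul_zero] } : Submodule k k)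

/-- The generator `1` of `kS(X, X) = k`. -/
def discOne (k : Type u) [CommRing k] {S : Type v} (X : S) : discHom k X X :=
  ⟨1, fun h => absurd rfl h⟩

/-- The morphism of quivers `kS → kT` induced by a map `φ : S → T`; on coefficients it is
`c ↦ c`. -/
def discMap (k : Type u) [CommRing k] {S : Type v₁} {T : Type v₂} (φ : S → T) (X Y : S) :
    discHom k X Y →ₗ[k] discHom k (φ X) (φ Y) :=
  Submodule.inclusion fun _ hc h => hc fun e => h (congrArg φ e)

/-- The canonical isomorphism `B → kS ⊗ B`, `t ↦ 1_X ⊗ t`. For `B = kS` this is the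
comultiplication of `kS`. -/
def leftUnitInv {S : Type v} (B : S → S → ModuleCat.{w} k) (X Z : S) :
    B X Z →ₗ[k] TensorHom (discHom k) B X Z :=
  tensorIncl (discHom k) B X X Z ∘ₗ TensorProduct.mk k _ _ (discOne k X)

/-- The canonical isomorphism `B → B ⊗ kS`, `t ↦ t ⊗ 1_Z`. -/
def rightUnitInv {S : Type v} (B : S → S → ModuleCat.{w} k) (X Z : S) :
    B X Z →ₗ[k] TensorHom B (discHom k) X Z :=
  tensorIncl B (discHom k) X Z Z ∘ₗ (TensorProduct.mk k _ _).flip (discOne k Z)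

/-- The structure of an augmented cocategory on a cocategory `C`: a counit `ε : C → k Ob C` and a
morphism of counital cocategories `η : k Ob C → C`, both over the identity of `Ob C`, with
`ε ∘ η = id`. -/
structure Augmentation (C : Cocategory.{u, v, w} k) where
  ε : ∀ X Y, C.Hom X Y →ₗ[k] discHom k X Y
  counit_left : ∀ X Z, tensorMap (fun X => X) ε (fun _ _ => LinearMap.id) X Z ∘ₗ C.Δ X Z =
    leftUnitInv C.Hom X Z
  counit_right : ∀ X Z, tensorMap (fun X => X) (fun _ _ => LinearMap.id) ε X Z ∘ₗ C.Δ X Z =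
    rightUnitInv C.Hom X Z
  η : ∀ X Y, discHom k X Y →ₗ[k] C.Hom X Y
  η_comm : ∀ X Z, C.Δ X Z ∘ₗ η X Z =
    tensorMap (fun X => X) η η X Z ∘ₗ leftUnitInv (discHom k) X Z
  ε_η : ∀ X Y, ε X Y ∘ₗ η X Y = LinearMap.id

namespace Augmentation

variable {C D E : Cocategory.{u, v, w} k}

/-- A cocategory homomorphism is compatible with the counits and the augmentations. -/
structure Compatible (a : Augmentation C) (b : Augmentation D) (f : C.Mor D) : Prop where
  ε_comm : ∀ X Y, b.ε (f.obj X) (f.obj Y) ∘ₗ f.map X Y = discMap k f.obj X Y ∘ₗ a.ε X Y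
  η_comm : ∀ X Y, f.map X Y ∘ₗ a.η X Y = b.η (f.obj X) (f.obj Y) ∘ₗ discMap k f.obj X Y

lemma Compatible.id (a : Augmentation C) : a.Compatible a (Cocategory.Mor.id C) where
  ε_comm _ _ := rfl
  η_comm _ _ := rfl

lemma Compatible.comp {a : Augmentation C} {b : Augmentation D} {c : Augmentation E}
    {f : C.Mor D} {g : D.Mor E} (hf : a.Compatible b f) (hg : b.Compatible c g) :
    a.Compatible c (f.comp g) where
  ε_comm X Y := by
    change c.ε _ _ ∘ₗ (g.map _ _ ∘ₗ f.map X Y) = (discMap k g.obj _ _ ∘ₗ discMap k f.obj X Y) ∘ₗ _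
    rw [← LinearMap.comp_assoc, hg.ε_comm, LinearMap.comp_assoc, hf.ε_comm, LinearMap.comp_assoc]
  η_comm X Y := by
    change (g.map _ _ ∘ₗ f.map X Y) ∘ₗ _ = c.η _ _ ∘ₗ (discMap k g.obj _ _ ∘ₗ discMap k f.obj X Y)
    rw [LinearMap.comp_assoc, hf.η_comm, ← LinearMap.comp_assoc, hg.η_comm, LinearMap.comp_assoc]

/-- The reduced quiver `Ker ε`. -/
def redHom (a : Augmentation C) (X Y : C.Ob) : ModuleCat.{w} k :=
  ModuleCat.of k (LinearMap.ker (a.ε X Y))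

/-- The inclusion `Ker ε → C`. -/
def incl (a : Augmentation C) (X Y : C.Ob) : a.redHom X Y →ₗ[k] C.Hom X Y :=
  (LinearMap.ker (a.ε X Y)).subtype

/-- The projection `1 - η ∘ ε : C → Ker ε` of `C = Im η ⊕ Ker ε`. -/
def proj (a : Augmentation C) (X Y : C.Ob) : C.Hom X Y →ₗ[k] a.redHom X Y :=
  LinearMap.codRestrict (LinearMap.ker (a.ε X Y)) (LinearMap.id - a.η X Y ∘ₗ a.ε X Y) fun t => by
    have h := LinearMap.congr_fun (a.ε_η X Y) (a.ε X Y t)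
    simp only [LinearMap.comp_apply, LinearMap.id_apply] at h
    simp [h]

lemma proj_comp_η (a : Augmentation C) (X Y : C.Ob) : a.proj X Y ∘ₗ a.η X Y = 0 := by
  refine LinearMap.ext fun t => Subtype.ext ?_
  have h := LinearMap.congr_fun (a.ε_η X Y) t
  simp only [LinearMap.comp_apply, LinearMap.id_apply] at h
  change a.η X Y t - a.η X Y (a.ε X Y (a.η X Y t)) = 0
  rw [h, sub_self]

lemma incl_comp_proj (a : Augmentation C) (X Y : C.Ob) :
    a.incl X Y ∘ₗ a.proj X Y = LinearMap.id - a.η X Y ∘ₗ a.ε X Y := rfl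

/-- `(p ⊗ p) ∘ Δ` vanishes on the image of `η`, where `p = 1 - η ∘ ε`. -/
lemma proj_Δ_proj (a : Augmentation C) (X Z : C.Ob) :
    (tensorMap (fun X => X) a.proj a.proj X Z ∘ₗ C.Δ X Z) ∘ₗ (a.incl X Z ∘ₗ a.proj X Z) =
      tensorMap (fun X => X) a.proj a.proj X Z ∘ₗ C.Δ X Z := by
  have h : (tensorMap (fun X => X) a.proj a.proj X Z ∘ₗ C.Δ X Z) ∘ₗ a.η X Z = 0 := by
    rw [LinearMap.comp_assoc, a.η_comm, ← LinearMap.comp_assoc]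
    have := tensorMap_comp (fun X => X) (fun X => X) a.η a.η a.proj a.proj X Z
    rw [← this]
    refine LinearMap.ext fun t => ?_
    simp [leftUnitInv, tensorMap_incl, proj_comp_η]
  refine LinearMap.ext fun t => ?_
  have ht := LinearMap.congr_fun h (a.ε X Z t)
  simp only [LinearMap.comp_apply, LinearMap.zero_apply] at ht
  rw [incl_comp_proj]
  simp [ht]

lemma tensorProj_reduction (a : Augmentation C) (X Y Z : C.Ob) :
    tensorProj a.redHom a.redHom X Y Z ∘ₗ
        ((tensorMap (fun X => X) a.proj a.proj X Z ∘ₗ C.Δ X Z) ∘ₗ a.incl X Z) =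
      TensorProduct.map (a.proj X Y) (a.proj Y Z) ∘ₗ C.comp X Y Z ∘ₗ a.incl X Z := by
  rw [← LinearMap.comp_assoc, ← LinearMap.comp_assoc, tensorProj_comp_tensorMap]
  rfl

lemma tensorProj_reduction_proj (a : Augmentation C) (X Y Z : C.Ob) :
    (tensorProj a.redHom a.redHom X Y Z ∘ₗ
        ((tensorMap (fun X => X) a.proj a.proj X Z ∘ₗ C.Δ X Z) ∘ₗ a.incl X Z)) ∘ₗ a.proj X Z =
      TensorProduct.map (a.proj X Y) (a.proj Y Z) ∘ₗ C.comp X Y Z := by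
  rw [LinearMap.comp_assoc, LinearMap.comp_assoc, proj_Δ_proj, ← LinearMap.comp_assoc,
    tensorProj_comp_tensorMap]
  rfl

/-- The reduction of an augmented cocategory: the quiver `Ker ε` with the comultiplication
induced by `Δ` through the projection `1 - η ∘ ε` of `C` onto `Ker ε`. -/
def reduction (a : Augmentation C) : Cocategory.{u, v, w} k where
  Ob := C.Ob
  Hom := a.redHom
  Δ X Z := (tensorMap (fun X => X) a.proj a.proj X Z ∘ₗ C.Δ X Z) ∘ₗ a.incl X Z
  coassoc W X Y Z := by
    have hl : LinearMap.rTensor (a.redHom Y Z) (tensorProj a.redHom a.redHom W X Y ∘ₗ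
          ((tensorMap (fun X => X) a.proj a.proj W Y ∘ₗ C.Δ W Y) ∘ₗ a.incl W Y)) ∘ₗ
          TensorProduct.map (a.proj W Y) (a.proj Y Z) =
        TensorProduct.map (TensorProduct.map (a.proj W X) (a.proj X Y)) (a.proj Y Z) ∘ₗ
          LinearMap.rTensor (C.Hom Y Z) (C.comp W X Y) := by
      rw [LinearMap.rTensor_comp_map, tensorProj_reduction_proj, LinearMap.map_comp_rTensor]
    have hr : LinearMap.lTensor (a.redHom W X) (tensorProj a.redHom a.redHom X Y Z ∘ₗ
          ((tensorMap (fun X => X) a.proj a.proj X Z ∘ₗ C.Δ X Z) ∘ₗ a.incl X Z)) ∘ₗ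
          TensorProduct.map (a.proj W X) (a.proj X Z) =
        TensorProduct.map (a.proj W X) (TensorProduct.map (a.proj X Y) (a.proj Y Z)) ∘ₗ
          LinearMap.lTensor (C.Hom W X) (C.comp X Y Z) := by
      rw [LinearMap.lTensor_comp_map, tensorProj_reduction_proj, LinearMap.map_comp_lTensor]
    refine LinearMap.ext fun t => ?_
    have h₁ := LinearMap.congr_fun (a.tensorProj_reduction W Y Z) t
    have h₂ := LinearMap.congr_fun (a.tensorProj_reduction W X Z) t
    have h₃ := LinearMap.congr_fun hl (C.comp W Y Z (a.incl W Z t))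
    have h₄ := LinearMap.congr_fun hr (C.comp W X Z (a.incl W Z t))
    have h₅ := LinearMap.congr_fun (C.coassoc W X Y Z) (a.incl W Z t)
    have h₆ := LinearMap.congr_fun (TensorProduct.map_map_comp_assoc_eq
      (a.proj W X) (a.proj X Y) (a.proj Y Z))
      (LinearMap.rTensor (C.Hom Y Z) (C.comp W X Y) (C.comp W Y Z (a.incl W Z t)))
    refine (congrArg (fun s => TensorProduct.assoc k _ _ _ (LinearMap.rTensor _ _ s)) h₁).trans
      (Eq.trans ?_ (congrArg (fun s => LinearMap.lTensor _ _ s) h₂).symm)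
    refine (congrArg (TensorProduct.assoc k _ _ _) h₃).trans (h₆.symm.trans ?_)
    exact (congrArg (TensorProduct.map (a.proj W X)
      (TensorProduct.map (a.proj X Y) (a.proj Y Z))) h₅).trans h₄.symm

end Augmentation

/-- An augmented cocategory. -/
structure AugCocategory (k : Type u) [CommRing k] extends Cocategory.{u, v, w} k where
  aug : Augmentation toCocategory

/-- A morphism of augmented cocategories: a cocategory homomorphism compatible with the counit and
the augmentation. -/
structure AugCocategory.Mor (C D : AugCocategory.{u, v, w} k) extends
    toCMor : Cocategory.Mor C.toCocategory D.toCocategory where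
  compat : C.aug.Compatible D.aug toCMor

/-- The category of augmented cocategories. -/
instance : Category (AugCocategory.{u, v, w} k) where
  Hom C D := C.Mor D
  id C := ⟨Cocategory.Mor.id C.toCocategory, .id C.aug⟩
  comp f g := ⟨f.toCMor.comp g.toCMor, f.compat.comp g.compat⟩

/-- The category of cocomplete augmented cocategories: those whose reduction is cocomplete. -/
abbrev CocompleteAugCocategory (k : Type u) [CommRing k] :=
  ObjectProperty.FullSubcategory fun C : AugCocategory.{u, v, w} k => C.aug.reduction.IsCocomplete

/-- A graded augmented cocategory: the counit and the augmentation are of degree `0`, where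
`k Ob C` is concentrated in degree `0`. -/
structure GrAugCocategory (k : Type u) [CommRing k] extends GrCocategory.{u, v, w} k where
  aug : Augmentation toCocategory
  ε_deg : ∀ X Y n, n ≠ 0 → ∀ t ∈ deg X Y n, aug.ε X Y t = 0
  η_deg : ∀ X Y c, aug.η X Y c ∈ deg X Y 0

/-- A morphism of graded augmented cocategories. -/
structure GrAugCocategory.Mor (C D : GrAugCocategory.{u, v, w} k) extends
    toGrMor : GrCocategory.Mor C.toGrCocategory D.toGrCocategory where
  compat : C.aug.Compatible D.aug toCMor

/-- The category of graded augmented cocategories. -/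
instance : Category (GrAugCocategory.{u, v, w} k) where
  Hom C D := C.Mor D
  id C := ⟨GrCocategory.Mor.id C.toGrCocategory, .id C.aug⟩
  comp f g := ⟨f.toGrMor.comp g.toGrMor, f.compat.comp g.compat⟩

/-- The category of cocomplete graded augmented cocategories. -/
abbrev CocompleteGrAugCocategory (k : Type u) [CommRing k] :=
  ObjectProperty.FullSubcategory fun C : GrAugCocategory.{u, v, w} k =>
    C.aug.reduction.IsCocomplete

/-- A differential graded augmented cocategory: the counit and the augmentation are cochain maps
of degree `0`, where `k Ob C` is concentrated in degree `0` and has zero differential. -/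
structure DGAugCocategory (k : Type u) [CommRing k] extends DGCocategory.{u, v, w} k where
  aug : Augmentation toCocategory
  ε_deg : ∀ X Y n, n ≠ 0 → ∀ t ∈ deg X Y n, aug.ε X Y t = 0
  η_deg : ∀ X Y c, aug.η X Y c ∈ deg X Y 0
  ε_d : ∀ X Y, aug.ε X Y ∘ₗ d X Y = 0
  d_η : ∀ X Y, d X Y ∘ₗ aug.η X Y = 0

/-- A morphism of differential graded augmented cocategories. -/
structure DGAugCocategory.Mor (C D : DGAugCocategory.{u, v, w} k) extends
    toDGMor : DGCocategory.Mor C.toDGCocategory D.toDGCocategory where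
  compat : C.aug.Compatible D.aug toCMor

/-- The category of differential graded augmented cocategories. -/
instance : Category (DGAugCocategory.{u, v, w} k) where
  Hom C D := C.Mor D
  id C := ⟨DGCocategory.Mor.id C.toDGCocategory, .id C.aug⟩
  comp f g := ⟨f.toDGMor.comp g.toDGMor, f.compat.comp g.compat⟩

/-- The category of cocomplete differential graded augmented cocategories. -/
abbrev CocompleteDGAugCocategory (k : Type u) [CommRing k] :=
  ObjectProperty.FullSubcategory fun C : DGAugCocategory.{u, v, w} k =>
    C.aug.reduction.IsCocomplete

end

end Cocat

/-!
The equalizer of two homomorphisms `f g : C → D` is the largest subcocategory of `C` on which they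
agree. A subcocategory is a family of submodules `F(X, Y) ⊆ C(X, Y)`, on a set of objects, such
that every component of `Δ` maps `F(X, Z)` into `F(X, Y) ⊗ F(Y, Z)`. If `F` and `F'` are two such
families then `Δ(F + F') ⊆ F ⊗ F + F' ⊗ F' ⊆ (F + F') ⊗ (F + F')`; so the sum of all of those that
live on the objects `X` with `f X = g X` and on which `f = g` is again one of them
(`admissible_eqHom`). Since `k` is a field, `F ⊗ F → C ⊗ C` is injective, which makes `F` a
cocategory (`Subcocategory.toCocategory`). The image of any homomorphism `h : B → C` with
`f h = g h` is such a family (`admissible_imageHom`), so `h` factors through the largest one, and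
uniquely, since an inclusion is a monomorphism. Cocompleteness passes to subcocategories
(`Cocategory.IsCocomplete.of_injective`), because an iterated tensor product of injective maps is
injective.

In the graded and the differential graded cases one takes only the families stable under the
projections onto the homogeneous parts, and under the differential. Sums and images of
homomorphisms respect these conditions, and the degrees, the differential and the compatibilities
of `Δ` restrict to the largest family (`GrCocategory.restrict`, `DGCocategory.restrict`). That `Δ`
preserves the induced degrees rests on the description of the degree `n` part of `M ⊗ N` as the
common kernel of the maps `π_p ⊗ π_q` with `p + q ≠ n` (`mem_tensorDeg_iff`), which is tested
after an injective map.

In the augmented cases the image of `η` over the objects at which `f` and `g` agree is one of the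
families considered (`Augmentation.admissible_ηHom`), so the largest one inherits the
augmentation, and its reduction embeds into that of `C`.
-/

namespace Cocat

noncomputable section

/-! ### Tensor products of quivers over an injective map of objects -/

section Tensor

variable {k : Type u} [CommRing k] {S : Type v₁} {T : Type v₂}
  {A : S → S → ModuleCat.{w₁} k} {B : S → S → ModuleCat.{w₂} k}
  {A' : T → T → ModuleCat.{w₃} k} {B' : T → T → ModuleCat.{w₄} k}

lemma tensorProj_incl_self (X Y Z : S) (t : A X Y ⊗[k] B Y Z) :
    tensorProj A B X Y Z (tensorIncl A B X Y Z t) = t := by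
  simp [tensorProj, tensorIncl, DirectSum.component.lof_self]

lemma tensorProj_incl_of_ne {X Y Y' Z : S} (h : Y' ≠ Y) (t : A X Y' ⊗[k] B Y' Z) :
    tensorProj A B X Y Z (tensorIncl A B X Y' Z t) = 0 := by
  simp [tensorProj, tensorIncl, DirectSum.component.of, h]

lemma tensorHom_ext_proj {X Z : S} {s t : TensorHom A B X Z}
    (h : ∀ Y, tensorProj A B X Y Z s = tensorProj A B X Y Z t) : s = t :=
  DirectSum.ext_component k h

lemma tensorHom_induction {X Z : S} {p : TensorHom A B X Z → Prop} (h0 : p 0)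
    (hincl : ∀ Y t, p (tensorIncl A B X Y Z t)) (hadd : ∀ s t, p s → p t → p (s + t))
    (s : TensorHom A B X Z) : p s := by
  classical
  induction s using DirectSum.induction_on with
  | zero => exact h0
  | of Y t => exact hincl Y t
  | add s t hs ht => exact hadd s t hs ht

lemma mem_of_tensorProj_mem {X Z : S} (P : Submodule k (TensorHom A B X Z))
    (s : TensorHom A B X Z)
    (h : ∀ Y, tensorIncl A B X Y Z (tensorProj A B X Y Z s) ∈ P) : s ∈ P := by
  classical
  rw [← DirectSum.sum_support_of s]
  exact Submodule.sum_mem _ fun Y _ => h Y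

lemma tensorProj_tensorMap_of_injective {φ : S → T} (hφ : Function.Injective φ)
    (f : ∀ X Y, A X Y →ₗ[k] A' (φ X) (φ Y)) (g : ∀ X Y, B X Y →ₗ[k] B' (φ X) (φ Y))
    (X Y Z : S) (s : TensorHom A B X Z) :
    tensorProj A' B' (φ X) (φ Y) (φ Z) (tensorMap φ f g X Z s) =
      TensorProduct.map (f X Y) (g Y Z) (tensorProj A B X Y Z s) := by
  induction s using tensorHom_induction with
  | h0 => simp
  | hincl Y' t =>
    rw [tensorMap_incl]
    by_cases h : Y' = Y
    · subst h
      rw [tensorProj_incl_self, tensorProj_incl_self]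
    · rw [tensorProj_incl_of_ne h, tensorProj_incl_of_ne (hφ.ne h), map_zero]
  | hadd s t hs ht => simp only [map_add, hs, ht]

/-- The components of `(f ⊗ g)(s)` lie in any family of submodules that contains the images of the
maps `f_{X,Y} ⊗ g_{Y,Z}`. -/
lemma tensorProj_tensorMap_mem (φ : S → T)
    (f : ∀ X Y, A X Y →ₗ[k] A' (φ X) (φ Y)) (g : ∀ X Y, B X Y →ₗ[k] B' (φ X) (φ Y))
    (X Z : S) (P : ∀ Y, Submodule k (A' (φ X) Y ⊗[k] B' Y (φ Z)))
    (hP : ∀ Y t, TensorProduct.map (f X Y) (g Y Z) t ∈ P (φ Y)) (s : TensorHom A B X Z) (Y : T) :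
    tensorProj A' B' (φ X) Y (φ Z) (tensorMap φ f g X Z s) ∈ P Y := by
  induction s using tensorHom_induction with
  | h0 => simp
  | hincl Y' t =>
    rw [tensorMap_incl]
    by_cases h : φ Y' = Y
    · subst h
      rw [tensorProj_incl_self]
      exact hP _ _
    · rw [tensorProj_incl_of_ne h]
      exact zero_mem _
  | hadd s t hs ht =>
    rw [map_add, map_add]
    exact add_mem hs ht

end Tensor

section Field

variable {k : Type u} [Field k]

lemma map_injective {M : Type*} {N : Type*} {P : Type*} {Q : Type*} [AddCommGroup M] [Module k M]
    [AddCommGroup N] [Module k N] [AddCommGroup P] [Module k P] [AddCommGroup Q] [Module k Q]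
    {f : M →ₗ[k] P} {g : N →ₗ[k] Q} (hf : Function.Injective f) (hg : Function.Injective g) :
    Function.Injective (TensorProduct.map f g) :=
  TensorProduct.map_injective_of_flat_flat f g hf hg

lemma tensorMap_injective {S : Type v₁} {T : Type v₂}
    {A : S → S → ModuleCat.{w₁} k} {B : S → S → ModuleCat.{w₂} k}
    {A' : T → T → ModuleCat.{w₃} k} {B' : T → T → ModuleCat.{w₄} k}
    {φ : S → T} (hφ : Function.Injective φ)
    {f : ∀ X Y, A X Y →ₗ[k] A' (φ X) (φ Y)} {g : ∀ X Y, B X Y →ₗ[k] B' (φ X) (φ Y)}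
    (hf : ∀ X Y, Function.Injective (f X Y)) (hg : ∀ X Y, Function.Injective (g X Y)) (X Z : S) :
    Function.Injective (tensorMap φ f g X Z) := fun s t h =>
  tensorHom_ext_proj fun Y => map_injective (hf X Y) (hg Y Z) <| by
    rw [← tensorProj_tensorMap_of_injective hφ, h, tensorProj_tensorMap_of_injective hφ]

/-! ### Subcocategories -/

/-- A subcocategory of `C`: a set of objects and a family of submodules of the modules `C(X, Y)`,
stable under the comultiplication. The family is indexed by all the objects of `C`, and `hom X Y`
vanishes if `X` is not chosen; so stability also says that the components of the comultiplication
that run through an object which is not chosen are zero. The cocategory defined by these data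
involves `hom X Y` only for chosen `X` and `Y`. -/
structure Subcocategory (C : Cocategory.{u, v, w} k) where
  obj : Set C.Ob
  hom : ∀ X Y, Submodule k (C.Hom X Y)
  left_mem : ∀ X Y, ∀ t ∈ hom X Y, t ≠ 0 → X ∈ obj
  comp_mem : ∀ X Y Z, ∀ t ∈ hom X Z,
    C.comp X Y Z t ∈ Submodule.map₂ (TensorProduct.mk k _ _) (hom X Y) (hom Y Z)

namespace Subcocategory

variable {C : Cocategory.{u, v, w} k} (F : Subcocategory C)

/-- The underlying quiver of a subcocategory. -/
def quiver : KQuiver.{u, v, w} k where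
  Ob := F.obj
  Hom X Y := ModuleCat.of k (F.hom X Y)

/-- The inclusion of the objects of a subcocategory. -/
def val (X : F.quiver.Ob) : C.Ob := X.1

lemma val_injective : Function.Injective F.val := Subtype.val_injective

/-- The inclusion of the modules of morphisms of a subcocategory. -/
def subtype (X Y : F.quiver.Ob) : F.quiver.Hom X Y →ₗ[k] C.Hom (F.val X) (F.val Y) :=
  (F.hom (F.val X) (F.val Y)).subtype

lemma subtype_injective (X Y : F.quiver.Ob) : Function.Injective (F.subtype X Y) :=
  Subtype.val_injective

/-- The map `F ⊗ F → C ⊗ C`, which is injective since `k` is a field. -/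
def tensorSubtype (X Z : F.quiver.Ob) :
    TensorHom F.quiver.Hom F.quiver.Hom X Z →ₗ[k] TensorHom C.Hom C.Hom (F.val X) (F.val Z) :=
  tensorMap F.val F.subtype F.subtype X Z

lemma tensorSubtype_injective (X Z : F.quiver.Ob) : Function.Injective (F.tensorSubtype X Z) :=
  tensorMap_injective F.val_injective F.subtype_injective F.subtype_injective X Z

lemma Δ_mem_range (X Z : F.quiver.Ob) (t : F.quiver.Hom X Z) :
    C.Δ (F.val X) (F.val Z) (F.subtype X Z t) ∈ LinearMap.range (F.tensorSubtype X Z) := by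
  refine mem_of_tensorProj_mem _ _ fun Y => ?_
  have h := F.comp_mem (F.val X) Y (F.val Z) _ t.2
  change C.comp (F.val X) Y (F.val Z) t.1 ∈ _ at h
  change tensorIncl C.Hom C.Hom (F.val X) Y (F.val Z) (C.comp (F.val X) Y (F.val Z) t.1) ∈ _
  by_cases hY : Y ∈ F.obj
  · rw [← TensorProduct.range_mapIncl] at h
    obtain ⟨s, hs⟩ := h
    refine ⟨tensorIncl F.quiver.Hom F.quiver.Hom X ⟨Y, hY⟩ Z s, ?_⟩
    exact (tensorMap_incl F.val F.subtype F.subtype X ⟨Y, hY⟩ Z s).trans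
      (congrArg (tensorIncl C.Hom C.Hom (F.val X) Y (F.val Z)) hs)
  · have h0 : F.hom Y (F.val Z) = ⊥ := (Submodule.eq_bot_iff _).2 fun t ht => by
      by_contra h0
      exact hY (F.left_mem _ _ t ht h0)
    rw [h0, Submodule.map₂_bot_right, Submodule.mem_bot] at h
    rw [h, map_zero]
    exact zero_mem _

/-- The comultiplication of a subcocategory. -/
def comul (X Z : F.quiver.Ob) :
    F.quiver.Hom X Z →ₗ[k] TensorHom F.quiver.Hom F.quiver.Hom X Z :=
  (LinearEquiv.ofInjective _ (F.tensorSubtype_injective X Z)).symm.toLinearMap ∘ₗ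
    LinearMap.codRestrict _ (C.Δ (F.val X) (F.val Z) ∘ₗ F.subtype X Z) (F.Δ_mem_range X Z)

lemma tensorSubtype_comul (X Z : F.quiver.Ob) :
    F.tensorSubtype X Z ∘ₗ F.comul X Z = C.Δ (F.val X) (F.val Z) ∘ₗ F.subtype X Z :=
  LinearMap.ext fun t => congrArg Subtype.val
    ((LinearEquiv.ofInjective _ (F.tensorSubtype_injective X Z)).apply_symm_apply
      ⟨C.Δ (F.val X) (F.val Z) (F.subtype X Z t), F.Δ_mem_range X Z t⟩)

lemma map_subtype_comul (X Y Z : F.quiver.Ob) :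
    TensorProduct.map (F.subtype X Y) (F.subtype Y Z) ∘ₗ
        (tensorProj F.quiver.Hom F.quiver.Hom X Y Z ∘ₗ F.comul X Z) =
      C.comp (F.val X) (F.val Y) (F.val Z) ∘ₗ F.subtype X Z := by
  refine LinearMap.ext fun t => ?_
  have h := LinearMap.congr_fun (F.tensorSubtype_comul X Z) t
  refine (tensorProj_tensorMap_of_injective F.val_injective
    F.subtype F.subtype X Y Z _).symm.trans ?_
  exact congrArg (tensorProj C.Hom C.Hom (F.val X) (F.val Y) (F.val Z)) h

/-- A subcocategory as a cocategory in its own right. -/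
def toCocategory : Cocategory.{u, v, w} k where
  toKQuiver := F.quiver
  Δ := F.comul
  coassoc W X Y Z := by
    refine LinearMap.ext fun t => ?_
    -- the map `F ⊗ (F ⊗ F) → C ⊗ (C ⊗ C)` is injective, so coassociativity is inherited from `C`
    apply map_injective (F.subtype_injective W X)
      (map_injective (F.subtype_injective X Y) (F.subtype_injective Y Z))
    have hl := F.map_subtype_comul W Y Z
    have hr := F.map_subtype_comul W X Z
    have h₁ := F.map_subtype_comul W X Y
    have h₂ := F.map_subtype_comul X Y Z
    set cWYZ := tensorProj F.quiver.Hom F.quiver.Hom W Y Z ∘ₗ F.comul W Z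
    set cWXZ := tensorProj F.quiver.Hom F.quiver.Hom W X Z ∘ₗ F.comul W Z
    set cWXY := tensorProj F.quiver.Hom F.quiver.Hom W X Y ∘ₗ F.comul W Y
    set cXYZ := tensorProj F.quiver.Hom F.quiver.Hom X Y Z ∘ₗ F.comul X Z
    have e₁ := LinearMap.congr_fun (TensorProduct.map_map_comp_assoc_eq
      (F.subtype W X) (F.subtype X Y) (F.subtype Y Z)) (LinearMap.rTensor _ cWXY (cWYZ t))
    have e₂ : TensorProduct.map (TensorProduct.map (F.subtype W X) (F.subtype X Y))
          (F.subtype Y Z) (LinearMap.rTensor _ cWXY (cWYZ t)) =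
        LinearMap.rTensor _ (C.comp (F.val W) (F.val X) (F.val Y))
          (C.comp (F.val W) (F.val Y) (F.val Z) (F.subtype W Z t)) := by
      rw [← LinearMap.comp_apply, LinearMap.map_comp_rTensor, h₁, ← LinearMap.rTensor_comp_map,
        LinearMap.comp_apply]
      exact congrArg _ (LinearMap.congr_fun hl t)
    have e₃ : TensorProduct.map (F.subtype W X)
          (TensorProduct.map (F.subtype X Y) (F.subtype Y Z)) (LinearMap.lTensor _ cXYZ (cWXZ t)) =
        LinearMap.lTensor _ (C.comp (F.val X) (F.val Y) (F.val Z))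
          (C.comp (F.val W) (F.val X) (F.val Z) (F.subtype W Z t)) := by
      rw [← LinearMap.comp_apply, LinearMap.map_comp_lTensor, h₂, ← LinearMap.lTensor_comp_map,
        LinearMap.comp_apply]
      exact congrArg _ (LinearMap.congr_fun hr t)
    refine Eq.trans ?_ e₃.symm
    refine e₁.trans ?_
    refine (congrArg (TensorProduct.assoc k _ _ _) e₂).trans ?_
    exact LinearMap.congr_fun (C.coassoc (F.val W) (F.val X) (F.val Y) (F.val Z)) (F.subtype W Z t)

/-- The inclusion of a subcocategory. -/
def incl : F.toCocategory.Mor C where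
  obj := F.val
  map := F.subtype
  comm X Z := (F.tensorSubtype_comul X Z).symm

/-- A homomorphism `h : B → C` takes values in the subcocategory `F` of `C`. -/
structure Contains {B : Cocategory.{u, v, w} k} (h : B.Mor C) : Prop where
  obj_mem : ∀ X, h.obj X ∈ F.obj
  map_mem : ∀ X Y t, h.map X Y t ∈ F.hom (h.obj X) (h.obj Y)

variable {F}

/-- The map of objects of the factorisation through `F` of a homomorphism with values in `F`. -/
def Contains.liftObj {B : Cocategory.{u, v, w} k} {h : B.Mor C} (hh : F.Contains h) (X : B.Ob) :
    F.quiver.Ob :=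
  ⟨h.obj X, hh.obj_mem X⟩

/-- The linear maps of the factorisation through `F` of a homomorphism with values in `F`. -/
def Contains.liftMap {B : Cocategory.{u, v, w} k} {h : B.Mor C} (hh : F.Contains h) (X Y : B.Ob) :
    B.Hom X Y →ₗ[k] F.quiver.Hom (hh.liftObj X) (hh.liftObj Y) :=
  LinearMap.codRestrict (F.hom (h.obj X) (h.obj Y)) (h.map X Y) (hh.map_mem X Y)

/-- The factorisation through `F` of a homomorphism with values in `F`. -/
def Contains.lift {B : Cocategory.{u, v, w} k} {h : B.Mor C} (hh : F.Contains h) :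
    B.Mor F.toCocategory where
  obj := hh.liftObj
  map := hh.liftMap
  comm X Z := by
    refine LinearMap.ext fun t => F.tensorSubtype_injective _ _ ?_
    refine (LinearMap.congr_fun (F.tensorSubtype_comul _ _) _).trans ?_
    refine (LinearMap.congr_fun (h.comm X Z) t).trans ?_
    exact LinearMap.congr_fun
      (tensorMap_comp hh.liftObj F.val hh.liftMap hh.liftMap F.subtype F.subtype X Z) (B.Δ X Z t)

lemma Contains.lift_incl {B : Cocategory.{u, v, w} k} {h : B.Mor C} (hh : F.Contains h) :
    hh.lift.comp F.incl = h := rfl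

end Subcocategory

end Field

/-! ### Comparison of homomorphisms -/

section Cast

variable {k : Type u} [CommRing k]

/-- The identification `D(X, Y) → D(X', Y')` for `X = X'` and `Y = Y'`. -/
def KQuiver.castHom (D : KQuiver.{u, v, w} k) {X X' Y Y' : D.Ob} (hX : X = X') (hY : Y = Y') :
    D.Hom X Y →ₗ[k] D.Hom X' Y' := by
  subst hX hY
  exact LinearMap.id

/-- Two homomorphisms agree on an element `t ∈ C(X, Y)`, where `X` and `Y` have the same images
under both. -/
def Cocategory.Mor.AgreeAt {C D : Cocategory.{u, v, w} k} (f g : C.Mor D) {X Y : C.Ob}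
    (t : C.Hom X Y) : Prop :=
  ∀ (hX : f.obj X = g.obj X) (hY : f.obj Y = g.obj Y), D.castHom hX hY (f.map X Y t) = g.map X Y t

lemma Cocategory.Mor.ext_of_agreeAt {C D : Cocategory.{u, v, w} k} {f g : C.Mor D}
    (hobj : ∀ X, f.obj X = g.obj X) (hmap : ∀ X Y (t : C.Hom X Y), f.AgreeAt g t) : f = g := by
  obtain ⟨⟨fo, fm⟩, hf⟩ := f
  obtain ⟨⟨go, gm⟩, hg⟩ := g
  obtain rfl : fo = go := funext hobj
  obtain rfl : fm = gm := by
    funext X Y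
    exact LinearMap.ext fun t => hmap X Y t rfl rfl
  rfl

lemma Cocategory.Mor.obj_eq_of_eq {C D : Cocategory.{u, v, w} k} {f g : C.Mor D} (h : f = g)
    (X : C.Ob) : f.obj X = g.obj X := by rw [h]

lemma Cocategory.Mor.agreeAt_of_eq {C D : Cocategory.{u, v, w} k} {f g : C.Mor D} (h : f = g)
    {X Y : C.Ob} (t : C.Hom X Y) : f.AgreeAt g t := by
  subst h
  exact fun _ _ => rfl

end Cast

section Field

variable {k : Type u} [Field k]

/-! ### Cocompleteness of subcocategories -/

/-- The tensor product along a path of a family of linear maps. -/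
def pathMap {S : Type v₁} {T : Type v₂} {A : S → S → ModuleCat.{w₁} k}
    {A' : T → T → ModuleCat.{w₂} k} (φ : S → T) (f : ∀ X Y, A X Y →ₗ[k] A' (φ X) (φ Y)) :
    ∀ (X : S) (l : List S) (Y : S), pathHom A X l Y →ₗ[k] pathHom A' (φ X) (l.map φ) (φ Y)
  | X, [], Y => f X Y
  | X, Z :: l, Y => TensorProduct.map (f X Z) (pathMap φ f Z l Y)

lemma pathMap_injective {S : Type v₁} {T : Type v₂} {A : S → S → ModuleCat.{w₁} k}
    {A' : T → T → ModuleCat.{w₂} k} {φ : S → T} {f : ∀ X Y, A X Y →ₗ[k] A' (φ X) (φ Y)}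
    (hf : ∀ X Y, Function.Injective (f X Y)) :
    ∀ (X : S) (l : List S) (Y : S), Function.Injective (pathMap φ f X l Y)
  | X, [], Y => hf X Y
  | X, Z :: l, Y => map_injective (hf X Z) (pathMap_injective hf Z l Y)

lemma pathMap_iterComul {C D : Cocategory.{u, v, w} k} (φ : C.Ob → D.Ob)
    (f : ∀ X Y, C.Hom X Y →ₗ[k] D.Hom (φ X) (φ Y))
    (hf : ∀ X Y Z t, TensorProduct.map (f X Y) (f Y Z) (C.comp X Y Z t) =
      D.comp (φ X) (φ Y) (φ Z) (f X Z t)) :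
    ∀ (X : C.Ob) (l : List C.Ob) (Y : C.Ob) (t : C.Hom X Y),
      pathMap φ f X l Y (C.iterComul X l Y t) = D.iterComul (φ X) (l.map φ) (φ Y) (f X Y t)
  | X, [], Y, t => rfl
  | X, Z :: l, Y, t => by
    have ih : pathMap φ f Z l Y ∘ₗ C.iterComul Z l Y =
        D.iterComul (φ Z) (l.map φ) (φ Y) ∘ₗ f Z Y :=
      LinearMap.ext fun s => pathMap_iterComul φ f hf Z l Y s
    change TensorProduct.map (f X Z) (pathMap φ f Z l Y)
        (LinearMap.lTensor _ (C.iterComul Z l Y) (C.comp X Z Y t)) =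
      LinearMap.lTensor _ (D.iterComul (φ Z) (l.map φ) (φ Y)) (D.comp (φ X) (φ Z) (φ Y) (f X Y t))
    rw [← hf, ← LinearMap.comp_apply, ← LinearMap.comp_apply, LinearMap.map_comp_lTensor, ih,
      ← LinearMap.lTensor_comp_map]
    rfl

/-- Cocompleteness is inherited along injective maps compatible with the comultiplications. -/
lemma Cocategory.IsCocomplete.of_injective {C D : Cocategory.{u, v, w} k} (hD : D.IsCocomplete)
    (φ : C.Ob → D.Ob) (f : ∀ X Y, C.Hom X Y →ₗ[k] D.Hom (φ X) (φ Y))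
    (hinj : ∀ X Y, Function.Injective (f X Y))
    (hf : ∀ X Y Z t, TensorProduct.map (f X Y) (f Y Z) (C.comp X Y Z t) =
      D.comp (φ X) (φ Y) (φ Z) (f X Z t)) : C.IsCocomplete := fun X Y t => by
  obtain ⟨n, hn, h⟩ := hD (φ X) (φ Y) (f X Y t)
  refine ⟨n, hn, fun l hl => pathMap_injective hinj X l Y ?_⟩
  rw [pathMap_iterComul φ f hf, h _ (by simpa using hl), map_zero]

lemma Subcocategory.isCocomplete {C : Cocategory.{u, v, w} k} (hC : C.IsCocomplete)
    (F : Subcocategory C) : F.toCocategory.IsCocomplete :=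
  hC.of_injective F.val F.subtype F.subtype_injective
    fun X Y Z => LinearMap.congr_fun (F.map_subtype_comul X Y Z)

/-! ### The largest subcocategory on which two homomorphisms agree -/

/-- A family of submodules `F(X, Y)` of the modules `C(X, Y)` is admissible for a pair of
homomorphisms `f`, `g` and a set of linear operators on the modules `C(X, Y)` if it vanishes unless
`f` and `g` agree at `X`, `f` and `g` agree on it, and it is stable under the comultiplication and
under the operators. For a graded cocategory the operators are the projections
onto the homogeneous parts; for a differential graded one, also the differential. -/
structure Admissible {C D : Cocategory.{u, v, w} k} (f g : C.Mor D) {ι : Type*}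
    (T : ι → ∀ X Y, C.Hom X Y →ₗ[k] C.Hom X Y) (F : ∀ X Y, Submodule k (C.Hom X Y)) : Prop where
  left_eq : ∀ X Y, ∀ t ∈ F X Y, t ≠ 0 → f.obj X = g.obj X
  agree : ∀ X Y, ∀ t ∈ F X Y, f.AgreeAt g t
  comp_mem : ∀ X Y Z, ∀ t ∈ F X Z,
    C.comp X Y Z t ∈ Submodule.map₂ (TensorProduct.mk k _ _) (F X Y) (F Y Z)
  op_mem : ∀ i X Y, ∀ t ∈ F X Y, T i X Y t ∈ F X Y

variable {C D : Cocategory.{u, v, w} k} (f g : C.Mor D) {ι : Type*}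
  (T : ι → ∀ X Y, C.Hom X Y →ₗ[k] C.Hom X Y)

/-- The sum of all admissible families. -/
def eqHom (X Y : C.Ob) : Submodule k (C.Hom X Y) :=
  ⨆ F : {F : ∀ X Y, Submodule k (C.Hom X Y) // Admissible f g T F}, F.1 X Y

variable {f g T}

lemma Admissible.le_eqHom {F : ∀ X Y, Submodule k (C.Hom X Y)} (hF : Admissible f g T F)
    (X Y : C.Ob) : F X Y ≤ eqHom f g T X Y :=
  le_iSup (fun F : {F : ∀ X Y, Submodule k (C.Hom X Y) // Admissible f g T F} => F.1 X Y) ⟨F, hF⟩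

variable (f g T)

/-- A sum of admissible families is admissible: `Δ(F + F')` is contained in
`F ⊗ F + F' ⊗ F'`, hence in `(F + F') ⊗ (F + F')`. -/
lemma admissible_eqHom : Admissible f g T (eqHom f g T) where
  left_eq X Y t ht := by
    refine Submodule.iSup_induction _ (motive := fun t => t ≠ 0 → f.obj X = g.obj X) ht
      (fun F t ht => F.2.left_eq X Y t ht) (fun h => absurd rfl h) fun s t hs ht hst => ?_
    by_cases h : s = 0
    · exact ht fun h' => hst (by rw [h, h', add_zero])
    · exact hs h
  agree X Y t ht := by
    refine Submodule.iSup_induction _ (motive := fun t => f.AgreeAt g t) ht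
      (fun F t ht => F.2.agree X Y t ht) (fun _ _ => by simp only [map_zero])
      fun s t hs ht hX hY => ?_
    simp only [map_add, hs hX hY, ht hX hY]
  comp_mem X Y Z t ht := by
    refine Submodule.iSup_induction _ (motive := fun t => C.comp X Y Z t ∈ Submodule.map₂
      (TensorProduct.mk k _ _) (eqHom f g T X Y) (eqHom f g T Y Z)) ht (fun F t ht => ?_)
      (by simp only [map_zero, zero_mem]) fun s t hs ht => ?_
    · exact Submodule.map₂_le_map₂ (F.2.le_eqHom X Y) (F.2.le_eqHom Y Z) (F.2.comp_mem X Y Z t ht)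
    · rw [map_add]
      exact add_mem hs ht
  op_mem i X Y t ht := by
    refine Submodule.iSup_induction _ (motive := fun t => T i X Y t ∈ eqHom f g T X Y) ht
      (fun F t ht => F.2.le_eqHom X Y (F.2.op_mem i X Y t ht))
      (by simp only [map_zero, zero_mem]) fun s t hs ht => ?_
    rw [map_add]
    exact add_mem hs ht

/-- The largest subcocategory of `C` on which `f` and `g` agree and which is stable under the
operators `T`. -/
def eqSub : Subcocategory C where
  obj := {X | f.obj X = g.obj X}
  hom := eqHom f g T
  left_mem := (admissible_eqHom f g T).left_eq
  comp_mem := (admissible_eqHom f g T).comp_mem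

lemma eqSub_incl_comp : (eqSub f g T).incl.comp f = (eqSub f g T).incl.comp g :=
  Cocategory.Mor.ext_of_agreeAt (fun X => X.2) fun X Y t =>
    (admissible_eqHom f g T).agree X.1 Y.1 t.1 t.2

/-! ### The image of a homomorphism -/

/-- The elements `h(s)` of `C`, for `s` a morphism of `B`. -/
inductive IsImage {B C : Cocategory.{u, v, w} k} (h : B.Mor C) : ∀ X Y, C.Hom X Y → Prop
  | mk (X Y : B.Ob) (s : B.Hom X Y) : IsImage h (h.obj X) (h.obj Y) (h.map X Y s)

/-- The submodule of `C(X, Y)` generated by the images of the morphisms of `B`, from all the objects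
over `X` to all the objects over `Y`. -/
def imageHom {B C : Cocategory.{u, v, w} k} (h : B.Mor C) (X Y : C.Ob) :
    Submodule k (C.Hom X Y) :=
  Submodule.span k {t | IsImage h X Y t}

lemma map_mem_imageHom {B C : Cocategory.{u, v, w} k} (h : B.Mor C) (X Y : B.Ob) (s : B.Hom X Y) :
    h.map X Y s ∈ imageHom h (h.obj X) (h.obj Y) :=
  Submodule.subset_span (IsImage.mk X Y s)

lemma imageHom_le {B C : Cocategory.{u, v, w} k} {h : B.Mor C}
    (P : ∀ X Y, Submodule k (C.Hom X Y)) (hP : ∀ X Y s, h.map X Y s ∈ P (h.obj X) (h.obj Y))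
    (X Y : C.Ob) : imageHom h X Y ≤ P X Y := by
  refine Submodule.span_le.2 ?_
  rintro _ ⟨X, Y, s⟩
  exact hP X Y s

lemma comp_mem_imageHom {B C : Cocategory.{u, v, w} k} (h : B.Mor C) (X Y Z : C.Ob)
    (t : C.Hom X Z) (ht : t ∈ imageHom h X Z) : C.comp X Y Z t ∈
      Submodule.map₂ (TensorProduct.mk k _ _) (imageHom h X Y) (imageHom h Y Z) := by
  refine imageHom_le (fun X Z => (Submodule.map₂ (TensorProduct.mk k _ _) (imageHom h X Y)
    (imageHom h Y Z)).comap (C.comp X Y Z)) (fun X Z s => ?_) X Z ht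
  rw [Submodule.mem_comap]
  have e : C.comp (h.obj X) Y (h.obj Z) (h.map X Z s) =
      tensorProj C.Hom C.Hom (h.obj X) Y (h.obj Z) (tensorMap h.obj h.map h.map X Z (B.Δ X Z s)) :=
    congrArg (tensorProj C.Hom C.Hom (h.obj X) Y (h.obj Z)) (LinearMap.congr_fun (h.comm X Z) s)
  refine (congrArg (· ∈ _) e).mpr <| tensorProj_tensorMap_mem h.obj h.map h.map X Z
    (fun Y => Submodule.map₂ (TensorProduct.mk k _ _) (imageHom h (h.obj X) Y)
      (imageHom h Y (h.obj Z))) (fun Y t => ?_) _ Y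
  induction t using TensorProduct.induction_on with
  | zero => simp
  | tmul a b =>
    exact Submodule.apply_mem_map₂ _ (map_mem_imageHom h X Y a) (map_mem_imageHom h Y Z b)
  | add s t hs ht =>
    rw [map_add]
    exact add_mem hs ht

/-- The image of a homomorphism which equalizes `f` and `g` and whose image is stable under the
operators `T` is admissible. -/
lemma admissible_imageHom {B : Cocategory.{u, v, w} k} {h : B.Mor C} (hfg : h.comp f = h.comp g)
    (hT : ∀ i X Y s, ∃ s', T i (h.obj X) (h.obj Y) (h.map X Y s) = h.map X Y s') :
    Admissible f g T (imageHom h) where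
  left_eq X Y t ht h0 := by
    by_contra hX
    refine h0 ((Submodule.mem_bot k).1 (Submodule.span_le (p := ⊥).2 ?_ ht))
    rintro _ ⟨X, Y, s⟩
    exact absurd (Cocategory.Mor.obj_eq_of_eq hfg X) hX
  agree X Y t ht hX hY := by
    refine LinearMap.mem_eqLocus.1 (Submodule.span_le
      (p := LinearMap.eqLocus (D.castHom hX hY ∘ₗ f.map X Y) (g.map X Y)).2 ?_ ht)
    rintro _ ⟨X, Y, s⟩
    exact Cocategory.Mor.agreeAt_of_eq hfg s hX hY
  comp_mem := comp_mem_imageHom h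
  op_mem i X Y t ht := by
    refine imageHom_le (fun X Y => (imageHom h X Y).comap (T i X Y)) (fun X Y s => ?_) X Y ht
    obtain ⟨s', hs'⟩ := hT i X Y s
    exact (congrArg (· ∈ _) hs').mpr (map_mem_imageHom h X Y s')

lemma eqSub_contains {B : Cocategory.{u, v, w} k} {h : B.Mor C} (hfg : h.comp f = h.comp g)
    (hT : ∀ i X Y s, ∃ s', T i (h.obj X) (h.obj Y) (h.map X Y s) = h.map X Y s') :
    (eqSub f g T).Contains h where
  obj_mem := Cocategory.Mor.obj_eq_of_eq hfg
  map_mem X Y s := (admissible_imageHom f g T hfg hT).le_eqHom _ _ (map_mem_imageHom h X Y s)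

/-- The inclusion of a subcocategory is a monomorphism. -/
lemma Subcocategory.incl_cancel {B C : Cocategory.{u, v, w} k} (F : Subcocategory C)
    {l l' : B.Mor F.toCocategory} (h : l.comp F.incl = l'.comp F.incl) : l = l' := by
  obtain ⟨⟨lo, lm⟩, hl⟩ := l
  obtain ⟨⟨lo', lm'⟩, hl'⟩ := l'
  obtain rfl : lo = lo' := funext fun X => F.val_injective (Cocategory.Mor.obj_eq_of_eq h X)
  obtain rfl : lm = lm' := by
    funext X Y
    exact LinearMap.ext fun t => F.subtype_injective _ _ (Cocategory.Mor.agreeAt_of_eq h t rfl rfl)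
  rfl

end Field

/-! ### Graded modules and their tensor products -/

section Graded

variable {k : Type u} [CommRing k]

section Module

variable {M : Type w₁} {N : Type w₂} [AddCommGroup M] [Module k M] [AddCommGroup N] [Module k N]
  {A : ℤ → Submodule k M} (hA : DirectSum.IsInternal A)
  {B : ℤ → Submodule k N} (hB : DirectSum.IsInternal B)

lemma linearMap_ext_of_isInternal (hA : DirectSum.IsInternal A) {P : Type*}
    [AddCommGroup P] [Module k P] {p q : M →ₗ[k] P} (h : ∀ n, ∀ t ∈ A n, p t = q t) : p = q := by
  have : ⊤ ≤ LinearMap.eqLocus p q := by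
    rw [← hA.submodule_iSup_eq_top]
    exact iSup_le h
  exact LinearMap.ext fun t => this trivial

/-- The projection of a graded module onto its part of degree `n`. -/
def gradedProj (n : ℤ) : M →ₗ[k] M :=
  (A n).subtype ∘ₗ DirectSum.component k ℤ (fun n => A n) n ∘ₗ
    (LinearEquiv.ofBijective (DirectSum.coeLinearMap A)
      (bijective_coeLinearMap hA)).symm.toLinearMap

lemma gradedProj_mem (n : ℤ) (t : M) : gradedProj hA n t ∈ A n := Subtype.property _

lemma gradedProj_apply {m : ℤ} {t : M} (ht : t ∈ A m) (n : ℤ) :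
    gradedProj hA n t = if m = n then t else 0 := by
  have h : (LinearEquiv.ofBijective (DirectSum.coeLinearMap A) (bijective_coeLinearMap hA)).symm t =
      DirectSum.lof k ℤ (fun n => A n) m ⟨t, ht⟩ := by
    rw [LinearEquiv.symm_apply_eq]
    simp
  simp only [gradedProj, LinearMap.comp_apply, LinearEquiv.coe_coe, h]
  by_cases hmn : m = n
  · subst hmn
    simp [DirectSum.component.lof_self]
  · simp [DirectSum.component.of, hmn]

lemma exists_sum_gradedProj (t : M) :
    ∃ s : Finset ℤ, ∀ s', s ⊆ s' → ∑ n ∈ s', gradedProj hA n t = t := by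
  have ht : t ∈ ⨆ n, A n := by rw [hA.submodule_iSup_eq_top]; trivial
  refine Submodule.iSup_induction A
    (motive := fun t => ∃ s : Finset ℤ, ∀ s', s ⊆ s' → ∑ n ∈ s', gradedProj hA n t = t) ht
    (fun m t ht => ⟨{m}, fun s' hs' => ?_⟩) ⟨∅, by simp⟩ ?_
  · simp only [gradedProj_apply hA ht]
    simp [Finset.singleton_subset_iff.1 hs']
  · rintro t t' ⟨s, hs⟩ ⟨s', hs'⟩
    refine ⟨s ∪ s', fun s'' h => ?_⟩
    simp only [map_add, Finset.sum_add_distrib, hs s'' (Finset.union_subset_left h),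
      hs' s'' (Finset.union_subset_right h)]

lemma map_gradedProj {φ : M →ₗ[k] N} (hφ : ∀ n, ∀ t ∈ A n, φ t ∈ B n) (n : ℤ) :
    φ ∘ₗ gradedProj hA n = gradedProj hB n ∘ₗ φ :=
  linearMap_ext_of_isInternal hA fun m t ht => by
    simp only [LinearMap.comp_apply, gradedProj_apply hA ht, gradedProj_apply hB (hφ m t ht)]
    split_ifs <;> simp

lemma map_gradedSign {φ : M →ₗ[k] N} (hφ : ∀ n, ∀ t ∈ A n, φ t ∈ B n) :
    φ ∘ₗ gradedSign A hA = gradedSign B hB ∘ₗ φ :=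
  linearMap_ext_of_isInternal hA fun m t ht => by
    simp only [LinearMap.comp_apply, gradedSign_apply A hA ht, gradedSign_apply B hB (hφ m t ht),
      map_zsmul]

lemma map_tensorDiff {M' N' : Type*} [AddCommGroup M'] [Module k M'] [AddCommGroup N']
    [Module k N'] {A' : ℤ → Submodule k M'} (hA' : DirectSum.IsInternal A')
    {dM : M →ₗ[k] M} {dN : N →ₗ[k] N} {dM' : M' →ₗ[k] M'} {dN' : N' →ₗ[k] N'}
    {φ : M →ₗ[k] M'} {ψ : N →ₗ[k] N'} (hφ : ∀ n, ∀ t ∈ A n, φ t ∈ A' n)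
    (hdφ : φ ∘ₗ dM = dM' ∘ₗ φ) (hdψ : ψ ∘ₗ dN = dN' ∘ₗ ψ) :
    TensorProduct.map φ ψ ∘ₗ tensorDiff A hA dM dN =
      tensorDiff A' hA' dM' dN' ∘ₗ TensorProduct.map φ ψ := by
  simp only [tensorDiff, LinearMap.comp_add, LinearMap.add_comp]
  rw [← TensorProduct.map_comp, ← TensorProduct.map_comp, ← TensorProduct.map_comp,
    ← TensorProduct.map_comp, hdφ, hdψ, map_gradedSign hA hA' hφ]
  rfl

/-- A submodule stable under the projections onto the homogeneous parts is graded. -/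
lemma isInternal_comap {φ : N →ₗ[k] M} (hφ : Function.Injective φ)
    (h : ∀ n t, gradedProj hA n (φ t) ∈ LinearMap.range φ) :
    DirectSum.IsInternal fun n => (A n).comap φ := by
  constructor
  · refine (injective_iff_map_eq_zero _).2 fun x hx => ?_
    have hz : ∀ x : ⨁ n, (A n).comap φ, ∀ n,
        gradedProj hA n (φ (DirectSum.coeLinearMap (fun n => (A n).comap φ) x)) = φ (x n) := by
      intro x n
      induction x using DirectSum.induction_on with
      | zero => simp
      | of m t =>
        rw [← DirectSum.lof_eq_of k, DirectSum.coeLinearMap_lof, gradedProj_apply hA t.2,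
          DirectSum.lof_eq_of]
        by_cases hmn : m = n
        · subst hmn
          simp
        · simp [hmn, DirectSum.of_eq_of_ne _ _ _ (Ne.symm hmn)]
      | add x y hx hy =>
        simp only [map_add, hx, hy]
        rw [DirectSum.add_apply, Submodule.coe_add, map_add]
    refine DirectSum.ext_component k fun n => Subtype.ext (hφ ?_)
    refine (hz x n).symm.trans ?_
    have hx' : DirectSum.coeLinearMap (fun n => (A n).comap φ) x = 0 := hx
    simp [hx']
  · intro t
    obtain ⟨s, hs⟩ := exists_sum_gradedProj hA (φ t)
    choose r hr using fun n => h n t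
    refine ⟨∑ n ∈ s, DirectSum.of (fun n => (A n).comap φ) n
      ⟨r n, by rw [Submodule.mem_comap, hr]; exact gradedProj_mem hA n _⟩, hφ ?_⟩
    rw [map_sum, map_sum]
    refine Eq.trans ?_ (hs s subset_rfl)
    exact Finset.sum_congr rfl fun n _ => by rw [DirectSum.coeAddMonoidHom_of, hr]

/-- The parts of a tensor product are detected by the projections `π_p ⊗ π_q`. -/
lemma mem_tensorDeg_iff (n : ℤ) (x : M ⊗[k] N) : x ∈ tensorDeg A B n ↔
    ∀ p q, p + q ≠ n → TensorProduct.map (gradedProj hA p) (gradedProj hB q) x = 0 := by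
  constructor
  · intro hx p q hpq
    suffices h : tensorDeg A B n ≤
        LinearMap.ker (TensorProduct.map (gradedProj hA p) (gradedProj hB q)) from h hx
    refine iSup_le fun p' => iSup_le fun q' => iSup_le fun h =>
      Submodule.map₂_le.2 fun a ha b hb => ?_
    rw [LinearMap.mem_ker, TensorProduct.mk_apply, TensorProduct.map_tmul, gradedProj_apply hA ha,
      gradedProj_apply hB hb]
    by_cases hp : p' = p
    · have hq : q' ≠ q := fun hq => hpq (by rw [← hp, ← hq, h])
      simp [hq]
    · simp [hp]
  · intro h
    have hs : ∃ s : Finset ℤ, ∀ s', s ⊆ s' → ∑ p ∈ s', ∑ q ∈ s',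
        TensorProduct.map (gradedProj hA p) (gradedProj hB q) x = x := by
      clear h
      induction x using TensorProduct.induction_on with
      | zero => exact ⟨∅, by simp⟩
      | tmul a b =>
        obtain ⟨s, hs⟩ := exists_sum_gradedProj hA a
        obtain ⟨s', hs'⟩ := exists_sum_gradedProj hB b
        refine ⟨s ∪ s', fun s'' h => ?_⟩
        simp only [TensorProduct.map_tmul, ← TensorProduct.tmul_sum, ← TensorProduct.sum_tmul,
          hs s'' (Finset.union_subset_left h), hs' s'' (Finset.union_subset_right h)]
      | add x y hx hy =>
        obtain ⟨s, hs⟩ := hx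
        obtain ⟨s', hs'⟩ := hy
        refine ⟨s ∪ s', fun s'' h => ?_⟩
        simp only [map_add, Finset.sum_add_distrib, hs s'' (Finset.union_subset_left h),
          hs' s'' (Finset.union_subset_right h)]
    obtain ⟨s, hs⟩ := hs
    rw [← hs s subset_rfl]
    refine Submodule.sum_mem _ fun p _ => Submodule.sum_mem _ fun q _ => ?_
    by_cases hpq : p + q = n
    · have hle : Submodule.map₂ (TensorProduct.mk k M N) (A p) (B q) ≤ tensorDeg A B n :=
        le_iSup_of_le p (le_iSup_of_le q (le_iSup_of_le hpq le_rfl))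
      clear h hs
      induction x using TensorProduct.induction_on with
      | zero => simp
      | tmul a b =>
        exact hle (Submodule.apply_mem_map₂ _ (gradedProj_mem hA p a) (gradedProj_mem hB q b))
      | add x y hx hy =>
        rw [map_add]
        exact add_mem hx hy
    · rw [h p q hpq]
      exact zero_mem _

end Module

/-- The factorisation of a linear map through an injective one. -/
def liftInjective {M N P : Type*} [AddCommGroup M] [Module k M] [AddCommGroup N] [Module k N]
    [AddCommGroup P] [Module k P] (i : N →ₗ[k] M) (hi : Function.Injective i) (p : P →ₗ[k] M)
    (h : ∀ x, p x ∈ LinearMap.range i) : P →ₗ[k] N :=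
  (LinearEquiv.ofInjective i hi).symm.toLinearMap ∘ₗ LinearMap.codRestrict _ p h

lemma apply_liftInjective {M N P : Type*} [AddCommGroup M] [Module k M] [AddCommGroup N]
    [Module k N] [AddCommGroup P] [Module k P] (i : N →ₗ[k] M) (hi : Function.Injective i)
    (p : P →ₗ[k] M) (h : ∀ x, p x ∈ LinearMap.range i) (x : P) :
    i (liftInjective i hi p h x) = p x :=
  congrArg Subtype.val ((LinearEquiv.ofInjective i hi).apply_symm_apply ⟨p x, h x⟩)

end Graded

/-! ### Structures induced on a subcocategory -/

/-- A homomorphism that is injective on objects and on the modules of morphisms. -/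
structure Cocategory.Mor.IsEmbedding {k : Type u} [CommRing k] {E C : Cocategory.{u, v, w} k}
    (i : E.Mor C) : Prop where
  obj_injective : Function.Injective i.obj
  map_injective : ∀ X Y, Function.Injective (i.map X Y)

section Field

variable {k : Type u} [Field k]

lemma Subcocategory.isEmbedding_incl {C : Cocategory.{u, v, w} k} (F : Subcocategory C) :
    F.incl.IsEmbedding where
  obj_injective := F.val_injective
  map_injective := F.subtype_injective

namespace Cocategory.Mor.IsEmbedding

variable {E C : Cocategory.{u, v, w} k} {i : E.Mor C}

lemma map_comp (hi : i.IsEmbedding) (X Y Z : E.Ob) :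
    TensorProduct.map (i.map X Y) (i.map Y Z) ∘ₗ E.comp X Y Z =
      C.comp (i.obj X) (i.obj Y) (i.obj Z) ∘ₗ i.map X Z := by
  refine LinearMap.ext fun t => ?_
  have h := LinearMap.congr_fun (i.comm X Z) t
  exact (tensorProj_tensorMap_of_injective hi.obj_injective i.map i.map X Y Z _).symm.trans
    (congrArg (tensorProj C.Hom C.Hom (i.obj X) (i.obj Y) (i.obj Z)) h.symm)

lemma map_map_injective (hi : i.IsEmbedding) (X Y Z : E.Ob) :
    Function.Injective (TensorProduct.map (i.map X Y) (i.map Y Z)) :=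
  Cocat.map_injective (hi.map_injective X Y) (hi.map_injective Y Z)

end Cocategory.Mor.IsEmbedding

section Graded

variable (C : GrCocategory.{u, v, w} k) {E : Cocategory.{u, v, w} k} {i : E.Mor C.toCocategory}
  (hi : i.IsEmbedding)
  (hproj : ∀ n X Y t, gradedProj (C.isInternal _ _) n (i.map X Y t) ∈ LinearMap.range (i.map X Y))

/-- The grading induced on the source of an embedding whose image is stable under the projections
onto the homogeneous parts. -/
def GrCocategory.restrict : GrCocategory.{u, v, w} k where
  toCocategory := E
  deg X Y n := (C.deg (i.obj X) (i.obj Y) n).comap (i.map X Y)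
  isInternal X Y := isInternal_comap (C.isInternal _ _) (hi.map_injective X Y)
    fun n t => hproj n X Y t
  Δ_deg X Y Z n t ht := by
    have hI := fun X Y => isInternal_comap (C.isInternal _ _) (hi.map_injective X Y)
      fun n t => hproj n X Y t
    have hmap := fun X Y n => map_gradedProj (hI X Y) (C.isInternal (i.obj X) (i.obj Y))
      (φ := i.map X Y) (fun _ _ h => h) n
    refine (mem_tensorDeg_iff (hI X Y) (hI Y Z) n _).2 fun p q hpq => ?_
    refine hi.map_map_injective X Y Z ?_
    have h := (mem_tensorDeg_iff (C.isInternal _ _) (C.isInternal _ _) n _).1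
      (C.Δ_deg (i.obj X) (i.obj Y) (i.obj Z) n (i.map X Z t) ht) p q hpq
    rw [map_zero, ← LinearMap.comp_apply, ← TensorProduct.map_comp, hmap, hmap,
      TensorProduct.map_comp]
    refine Eq.trans ?_ h
    exact congrArg (TensorProduct.map _ _) (LinearMap.congr_fun (hi.map_comp X Y Z) t)

/-- An embedding as a homomorphism of graded cocategories, for the induced grading. -/
def GrCocategory.restrictIncl : (C.restrict hi hproj).Mor C where
  toCMor := i
  map_deg _ _ _ _ ht := ht

end Graded

section DG

variable (C : DGCocategory.{u, v, w} k) {E : Cocategory.{u, v, w} k} {i : E.Mor C.toCocategory}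
  (hi : i.IsEmbedding)
  (hproj : ∀ n X Y t, gradedProj (C.isInternal _ _) n (i.map X Y t) ∈ LinearMap.range (i.map X Y))
  (hd : ∀ X Y t, C.d _ _ (i.map X Y t) ∈ LinearMap.range (i.map X Y))

/-- The differential induced on the source of an embedding whose image is stable under the
differential. -/
def DGCocategory.restrictD (X Y : E.Ob) : E.Hom X Y →ₗ[k] E.Hom X Y :=
  liftInjective (i.map X Y) (hi.map_injective X Y) (C.d (i.obj X) (i.obj Y) ∘ₗ i.map X Y) (hd X Y)

lemma DGCocategory.map_restrictD (X Y : E.Ob) :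
    i.map X Y ∘ₗ C.restrictD hi hd X Y = C.d (i.obj X) (i.obj Y) ∘ₗ i.map X Y :=
  LinearMap.ext fun t => apply_liftInjective _ _ _ _ t

/-- The structure of a differential graded cocategory induced on the source of an embedding whose
image is stable under the differential and the projections onto the homogeneous parts. -/
def DGCocategory.restrict : DGCocategory.{u, v, w} k where
  toGrCocategory := C.toGrCocategory.restrict hi hproj
  d := C.restrictD hi hd
  d_deg X Y n t ht := by
    exact (congrArg (· ∈ C.deg (i.obj X) (i.obj Y) (n + 1))
      (LinearMap.congr_fun (C.map_restrictD hi hd X Y) t)).mpr (C.d_deg _ _ n _ ht)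
  d_d X Y := by
    refine LinearMap.ext fun t => hi.map_injective X Y ?_
    have h := LinearMap.congr_fun (C.map_restrictD hi hd X Y)
    refine (h (C.restrictD hi hd X Y t)).trans ?_
    refine (congrArg (C.d (i.obj X) (i.obj Y)) (h t)).trans ?_
    exact (LinearMap.congr_fun (C.d_d _ _) (i.map X Y t)).trans (map_zero (i.map X Y)).symm
  Δ_d X Y Z := by
    have hI := (C.toGrCocategory.restrict hi hproj).isInternal X Y
    refine LinearMap.ext fun t => hi.map_map_injective X Y Z ?_
    have hc := fun t => LinearMap.congr_fun (hi.map_comp X Y Z) t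
    have hdt := LinearMap.congr_fun (C.map_restrictD hi hd X Z) t
    -- the map `i ⊗ i` commutes with the differentials of the tensor products
    have htens := map_tensorDiff hI (C.isInternal (i.obj X) (i.obj Y)) (φ := i.map X Y)
      (fun _ _ h => h) (C.map_restrictD hi hd X Y) (C.map_restrictD hi hd Y Z)
    refine (hc (C.restrictD hi hd X Z t)).trans ?_
    refine (congrArg (C.comp (i.obj X) (i.obj Y) (i.obj Z)) hdt).trans ?_
    refine (LinearMap.congr_fun (C.Δ_d (i.obj X) (i.obj Y) (i.obj Z)) (i.map X Z t)).trans ?_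
    refine Eq.trans ?_ (LinearMap.congr_fun htens (E.comp X Y Z t)).symm
    exact congrArg (tensorDiff _ _ _ _) (hc t).symm

/-- An embedding as a homomorphism of differential graded cocategories, for the induced
structure. -/
def DGCocategory.restrictIncl : (C.restrict hi hproj hd).Mor C where
  toGrMor := C.toGrCocategory.restrictIncl hi hproj
  map_d X Y := (C.map_restrictD hi hd X Y).symm

end DG

end Field

section Field

variable {k : Type u} [Field k]

/-! ### Augmentations -/

/-- The inverse of `discMap k φ X Y` for an injective map `φ : S → T`. -/
def discInv (k : Type u) [CommRing k] {S : Type v₁} {T : Type v₂} {φ : S → T}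
    (hφ : Function.Injective φ) (X Y : S) : discHom k (φ X) (φ Y) →ₗ[k] discHom k X Y :=
  Submodule.inclusion fun _ hc h => hc fun e => h (hφ e)

namespace Augmentation

section Restrict

variable {E C : Cocategory.{u, v, w} k} {i : E.Mor C} (a : Augmentation C) (hi : i.IsEmbedding)
  (hη : ∀ X Y c, a.η (i.obj X) (i.obj Y) (discMap k i.obj X Y c) ∈ LinearMap.range (i.map X Y))

/-- The map `η` induced on the source of an embedding, whose image contains the values of `η` on
the objects of the source. -/
def restrictη (X Y : E.Ob) : discHom k X Y →ₗ[k] E.Hom X Y :=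
  liftInjective (i.map X Y) (hi.map_injective X Y)
    (a.η (i.obj X) (i.obj Y) ∘ₗ discMap k i.obj X Y) (hη X Y)

lemma map_restrictη (X Y : E.Ob) (c : discHom k X Y) :
    i.map X Y (a.restrictη hi hη X Y c) = a.η (i.obj X) (i.obj Y) (discMap k i.obj X Y c) :=
  apply_liftInjective _ _ _ _ c

/-- The counit induced on the source of an embedding. -/
def restrictε (X Y : E.Ob) : E.Hom X Y →ₗ[k] discHom k X Y :=
  discInv k hi.obj_injective X Y ∘ₗ a.ε (i.obj X) (i.obj Y) ∘ₗ i.map X Y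

lemma discMap_restrictε (X Y : E.Ob) (t : E.Hom X Y) :
    discMap k i.obj X Y (a.restrictε hi X Y t) = a.ε (i.obj X) (i.obj Y) (i.map X Y t) := rfl

lemma discMap_injective {S : Type v₁} {T : Type v₂} (φ : S → T) (X Y : S) :
    Function.Injective (discMap k φ X Y) :=
  Submodule.inclusion_injective _

lemma discMap_one {S : Type v₁} {T : Type v₂} (φ : S → T) (X : S) :
    discMap k φ X X (discOne k X) = discOne k (φ X) := rfl

/-- The augmentation of the source of an embedding whose image contains the values of `η` on the
objects of the source. -/
def restrict : Augmentation E where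
  ε := a.restrictε hi
  counit_left X Z := by
    refine LinearMap.ext fun t => tensorMap_injective hi.obj_injective
      (discMap_injective (k := k) i.obj) hi.map_injective X Z ?_
    have h := LinearMap.congr_fun (a.counit_left (i.obj X) (i.obj Z)) (i.map X Z t)
    have hc := LinearMap.congr_fun (i.comm X Z) t
    simp only [LinearMap.comp_apply] at h hc ⊢
    rw [hc, ← LinearMap.comp_apply, ← tensorMap_comp] at h
    have e := tensorMap_comp (fun X => X) i.obj (a.restrictε hi)
      (fun _ _ => LinearMap.id) (discMap k i.obj) i.map X Z
    refine (LinearMap.congr_fun e (E.Δ X Z t)).symm.trans (h.trans ?_)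
    simp only [leftUnitInv, LinearMap.comp_apply, TensorProduct.mk_apply, tensorMap_incl,
      TensorProduct.map_tmul, discMap_one]
  counit_right X Z := by
    refine LinearMap.ext fun t => tensorMap_injective hi.obj_injective hi.map_injective
      (discMap_injective (k := k) i.obj) X Z ?_
    have h := LinearMap.congr_fun (a.counit_right (i.obj X) (i.obj Z)) (i.map X Z t)
    have hc := LinearMap.congr_fun (i.comm X Z) t
    simp only [LinearMap.comp_apply] at h hc ⊢
    rw [hc, ← LinearMap.comp_apply, ← tensorMap_comp] at h
    have e := tensorMap_comp (fun X => X) i.obj (fun _ _ => LinearMap.id)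
      (a.restrictε hi) i.map (discMap k i.obj) X Z
    refine (LinearMap.congr_fun e (E.Δ X Z t)).symm.trans (h.trans ?_)
    simp only [rightUnitInv, LinearMap.comp_apply, LinearMap.flip_apply, TensorProduct.mk_apply,
      tensorMap_incl, TensorProduct.map_tmul, discMap_one]
  η := a.restrictη hi hη
  η_comm X Z := by
    refine LinearMap.ext fun c => tensorMap_injective hi.obj_injective hi.map_injective
      hi.map_injective X Z ?_
    have h := LinearMap.congr_fun (a.η_comm (i.obj X) (i.obj Z)) (discMap k i.obj X Z c)
    have hc := LinearMap.congr_fun (i.comm X Z) (a.restrictη hi hη X Z c)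
    simp only [LinearMap.comp_apply] at h hc ⊢
    rw [← hc, map_restrictη, h]
    simp only [leftUnitInv, LinearMap.comp_apply, TensorProduct.mk_apply, tensorMap_incl,
      TensorProduct.map_tmul, map_restrictη, discMap_one]
  ε_η X Y := by
    refine LinearMap.ext fun c => discMap_injective (k := k) i.obj X Y ?_
    rw [LinearMap.comp_apply, discMap_restrictε, map_restrictη]
    exact LinearMap.congr_fun (a.ε_η _ _) _

lemma restrict_compatible : (a.restrict hi hη).Compatible a i where
  ε_comm _ _ := rfl
  η_comm X Y := LinearMap.ext fun c => a.map_restrictη hi hη X Y c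

/-- Compatibility with the induced augmentation is tested after composition with the embedding. -/
lemma Compatible.of_restrict {B : Cocategory.{u, v, w} k} {b : Augmentation B} {l : B.Mor E}
    (h : b.Compatible a (l.comp i)) : b.Compatible (a.restrict hi hη) l where
  ε_comm X Y := LinearMap.ext fun t => discMap_injective (k := k) i.obj _ _
    (LinearMap.congr_fun (h.ε_comm X Y) t)
  η_comm X Y := LinearMap.ext fun c => hi.map_injective _ _
    ((LinearMap.congr_fun (h.η_comm X Y) c).trans
      (a.map_restrictη hi hη (l.obj X) (l.obj Y) (discMap k l.obj X Y c)).symm)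

lemma reduction_comp (X Y Z : C.Ob) (t : a.redHom X Z) :
    a.reduction.comp X Y Z t =
      TensorProduct.map (a.proj X Y) (a.proj Y Z) (C.comp X Y Z (a.incl X Z t)) :=
  LinearMap.congr_fun (a.tensorProj_reduction X Y Z) t

lemma mem_ker_of_restrict (X Y : E.Ob) (t : (a.restrict hi hη).redHom X Y) :
    i.map X Y ((a.restrict hi hη).incl X Y t) ∈ LinearMap.ker (a.ε (i.obj X) (i.obj Y)) := by
  rw [LinearMap.mem_ker]
  exact congrArg (discMap k i.obj X Y) (LinearMap.mem_ker.1 t.2)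

/-- The map of reductions induced by an embedding. -/
def redMap (X Y : E.Ob) : (a.restrict hi hη).redHom X Y →ₗ[k] a.redHom (i.obj X) (i.obj Y) :=
  LinearMap.codRestrict _ (i.map X Y ∘ₗ (a.restrict hi hη).incl X Y)
    (a.mem_ker_of_restrict hi hη X Y)

lemma redMap_proj (X Y : E.Ob) :
    a.redMap hi hη X Y ∘ₗ (a.restrict hi hη).proj X Y =
      a.proj (i.obj X) (i.obj Y) ∘ₗ i.map X Y := by
  refine LinearMap.ext fun t => Subtype.ext ?_
  change i.map X Y (t - a.restrictη hi hη X Y (a.restrictε hi X Y t)) =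
    i.map X Y t - a.η _ _ (a.ε _ _ (i.map X Y t))
  rw [map_sub, map_restrictη, discMap_restrictε]

lemma map_redMap_reduction_comp (X Y Z : E.Ob) (t : (a.restrict hi hη).redHom X Z) :
    TensorProduct.map (a.redMap hi hη X Y) (a.redMap hi hη Y Z)
        ((a.restrict hi hη).reduction.comp X Y Z t) =
      a.reduction.comp (i.obj X) (i.obj Y) (i.obj Z) (a.redMap hi hη X Z t) := by
  rw [reduction_comp, reduction_comp, ← LinearMap.comp_apply, ← TensorProduct.map_comp,
    redMap_proj, redMap_proj, TensorProduct.map_comp, LinearMap.comp_apply]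
  exact congrArg (TensorProduct.map (a.proj _ _) (a.proj _ _))
    (LinearMap.congr_fun (hi.map_comp X Y Z) ((a.restrict hi hη).incl X Z t))

lemma isCocomplete_restrict (ha : a.reduction.IsCocomplete) :
    (a.restrict hi hη).reduction.IsCocomplete :=
  ha.of_injective i.obj (a.redMap hi hη)
    (fun X Y _ _ h => Subtype.ext (hi.map_injective X Y (congrArg Subtype.val h)))
    (a.map_redMap_reduction_comp hi hη)

end Restrict

section Equalizer

variable {C D : Cocategory.{u, v, w} k} {f g : C.Mor D} {ι : Type*}
  {T : ι → ∀ X Y, C.Hom X Y →ₗ[k] C.Hom X Y}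

/-- The image of `η`, restricted to the objects at which `f` and `g` agree. -/
def ηHom (a : Augmentation C) (f g : C.Mor D) (X Y : C.Ob) : Submodule k (C.Hom X Y) :=
  Submodule.span k {t | f.obj X = g.obj X ∧ ∃ c, a.η X Y c = t}

lemma castHom_η (b : Augmentation D) {X X' Y Y' : D.Ob} (hX : X = X') (hY : Y = Y')
    (c : discHom k X Y) (c' : discHom k X' Y') (h : c.1 = c'.1) :
    D.castHom hX hY (b.η X Y c) = b.η X' Y' c' := by
  subst hX hY
  obtain rfl : c = c' := Subtype.ext h
  rfl

lemma comp_η (a : Augmentation C) (X Y Z : C.Ob) (c : discHom k X Z) :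
    C.comp X Y Z (a.η X Z c) = tensorProj C.Hom C.Hom X Y Z
      (tensorIncl C.Hom C.Hom X X Z (a.η X X (discOne k X) ⊗ₜ a.η X Z c)) := by
  refine (congrArg (tensorProj C.Hom C.Hom X Y Z)
    (LinearMap.congr_fun (a.η_comm X Z) c)).trans (congrArg (tensorProj C.Hom C.Hom X Y Z) ?_)
  simp only [leftUnitInv, LinearMap.comp_apply, TensorProduct.mk_apply, tensorMap_incl,
    TensorProduct.map_tmul]

lemma admissible_ηHom (a : Augmentation C) {b : Augmentation D} (hf : a.Compatible b f)
    (hg : a.Compatible b g) (hT : ∀ i X Y c, ∃ c', T i X Y (a.η X Y c) = a.η X Y c') :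
    Admissible f g T (a.ηHom f g) where
  left_eq X Y t ht h0 := by
    by_contra hX
    refine h0 ((Submodule.mem_bot k).1 (Submodule.span_le (p := ⊥).2 ?_ ht))
    rintro t ⟨h, -⟩
    exact absurd h hX
  agree X Y t ht hX hY := by
    refine LinearMap.mem_eqLocus.1 (Submodule.span_le
      (p := LinearMap.eqLocus (D.castHom hX hY ∘ₗ f.map X Y) (g.map X Y)).2 ?_ ht)
    rintro _ ⟨-, c, rfl⟩
    refine (congrArg (D.castHom hX hY) (LinearMap.congr_fun (hf.η_comm X Y) c)).trans
      (Eq.trans ?_ (LinearMap.congr_fun (hg.η_comm X Y) c).symm)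
    exact castHom_η b hX hY _ _ rfl
  comp_mem X Y Z t ht := by
    refine Submodule.span_le (p := (Submodule.map₂ (TensorProduct.mk k _ _) (a.ηHom f g X Y)
      (a.ηHom f g Y Z)).comap (C.comp X Y Z)).2 ?_ ht
    rintro _ ⟨hX, c, rfl⟩
    rw [SetLike.mem_coe, Submodule.mem_comap, comp_η]
    by_cases h : X = Y
    · subst h
      rw [tensorProj_incl_self]
      exact Submodule.apply_mem_map₂ _ (Submodule.subset_span ⟨hX, _, rfl⟩)
        (Submodule.subset_span ⟨hX, _, rfl⟩)
    · rw [tensorProj_incl_of_ne h]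
      exact zero_mem _
  op_mem i X Y t ht := by
    refine Submodule.span_le (p := (a.ηHom f g X Y).comap (T i X Y)).2 ?_ ht
    rintro _ ⟨hX, c, rfl⟩
    obtain ⟨c', hc'⟩ := hT i X Y c
    exact Submodule.subset_span ⟨hX, c', hc'.symm⟩

/-- The largest subcocategory on which two augmented homomorphisms agree contains the image of
`η`. -/
lemma η_mem_eqSub (a : Augmentation C) {b : Augmentation D} (hf : a.Compatible b f)
    (hg : a.Compatible b g) (hT : ∀ i X Y c, ∃ c', T i X Y (a.η X Y c) = a.η X Y c')
    (X Y : (eqSub f g T).toCocategory.Ob) (c : discHom k X Y) :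
    a.η ((eqSub f g T).incl.obj X) ((eqSub f g T).incl.obj Y)
      (discMap k (eqSub f g T).incl.obj X Y c) ∈ LinearMap.range ((eqSub f g T).incl.map X Y) :=
  ⟨⟨_, (admissible_ηHom a hf hg hT).le_eqHom _ _ (Submodule.subset_span ⟨X.2, _, rfl⟩)⟩, rfl⟩

end Equalizer

end Augmentation

/-! ### Existence of equalizers -/

/-- A full subcategory has equalizers if each parallel pair of morphisms out of one of its objects
has an equalizer in the ambient category which belongs to the subcategory. -/
lemma hasEqualizers_fullSubcategory {𝒜 : Type*} [Category 𝒜] (P : ObjectProperty 𝒜)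
    (h : ∀ {A B : 𝒜} (_ : P A) (f g : A ⟶ B), ∃ (E : 𝒜) (i : E ⟶ A), P E ∧ i ≫ f = i ≫ g ∧
      ∀ (X : 𝒜) (s : X ⟶ A), s ≫ f = s ≫ g → ∃! l : X ⟶ E, l ≫ i = s) :
    HasEqualizers P.FullSubcategory := by
  refine @hasEqualizers_of_hasLimit_parallelPair _ _ fun {A B f g} => ?_
  obtain ⟨E, i, hE, hi, hu⟩ := h A.property f.hom g.hom
  let i' : (⟨E, hE⟩ : P.FullSubcategory) ⟶ A := ObjectProperty.homMk i
  refine ⟨⟨Fork.ofι i' (ObjectProperty.hom_ext _ hi), Fork.IsLimit.ofExistsUnique fun s => ?_⟩⟩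
  obtain ⟨l, hl, hl'⟩ := hu s.pt.obj s.ι.hom (congrArg (·.hom) s.condition)
  exact ⟨ObjectProperty.homMk l, ObjectProperty.hom_ext _ hl,
    fun m hm => ObjectProperty.hom_ext _ (hl' _ (congrArg (·.hom) hm))⟩

/-- The projections onto the homogeneous parts, as operators on a graded cocategory. -/
def grOp (C : GrCocategory.{u, v, w} k) (n : ℤ) (X Y : C.Ob) : C.Hom X Y →ₗ[k] C.Hom X Y :=
  gradedProj (C.isInternal X Y) n

/-- The projections onto the homogeneous parts and the differential (of index `none`), as operators
on a differential graded cocategory. -/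
def dgOp (C : DGCocategory.{u, v, w} k) (n : Option ℤ) (X Y : C.Ob) : C.Hom X Y →ₗ[k] C.Hom X Y :=
  n.elim (C.d X Y) fun n => grOp C.toGrCocategory n X Y

lemma GrCocategory.Mor.grOp_map {B C : GrCocategory.{u, v, w} k} (h : B.Mor C) (n : ℤ) (X Y : B.Ob)
    (s : B.Hom X Y) :
    grOp C n (h.obj X) (h.obj Y) (h.map X Y s) = h.map X Y (grOp B n X Y s) :=
  (LinearMap.congr_fun (map_gradedProj (B.isInternal X Y) (C.isInternal _ _) (h.map_deg X Y) n)
    s).symm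

lemma GrCocategory.Mor.exists_grOp_map {B C : GrCocategory.{u, v, w} k} (h : B.Mor C) (n : ℤ)
    (X Y : B.Ob) (s : B.Hom X Y) :
    ∃ s', grOp C n (h.obj X) (h.obj Y) (h.map X Y s) = h.map X Y s' :=
  ⟨_, h.grOp_map n X Y s⟩

lemma DGCocategory.Mor.exists_dgOp_map {B C : DGCocategory.{u, v, w} k} (h : B.Mor C) :
    ∀ (n : Option ℤ) (X Y : B.Ob) (s : B.Hom X Y),
      ∃ s', dgOp C n (h.obj X) (h.obj Y) (h.map X Y s) = h.map X Y s'
  | none, X, Y, s => ⟨_, LinearMap.congr_fun (h.map_d X Y) s⟩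
  | some n, X, Y, s => h.toGrMor.exists_grOp_map n X Y s

lemma exists_grOp_η {C : GrCocategory.{u, v, w} k} (a : Augmentation C.toCocategory)
    (ha : ∀ X Y c, a.η X Y c ∈ C.deg X Y 0) (n : ℤ) (X Y : C.Ob) (c : discHom k X Y) :
    ∃ c', grOp C n X Y (a.η X Y c) = a.η X Y c' := by
  rw [grOp, gradedProj_apply _ (ha X Y c)]
  split_ifs
  · exact ⟨c, rfl⟩
  · exact ⟨0, (map_zero _).symm⟩

lemma exists_dgOp_η {C : DGCocategory.{u, v, w} k} (a : Augmentation C.toCocategory)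
    (ha : ∀ X Y c, a.η X Y c ∈ C.deg X Y 0) (hd : ∀ X Y, C.d X Y ∘ₗ a.η X Y = 0) :
    ∀ (n : Option ℤ) (X Y : C.Ob) (c : discHom k X Y),
      ∃ c', dgOp C n X Y (a.η X Y c) = a.η X Y c'
  | none, X, Y, c => ⟨0, (LinearMap.congr_fun (hd X Y) c).trans (map_zero _).symm⟩
  | some n, X, Y, c => exists_grOp_η a ha n X Y c

lemma eqSub_op_mem_range {C D : Cocategory.{u, v, w} k} (f g : C.Mor D) {ι : Type*}
    (T : ι → ∀ X Y, C.Hom X Y →ₗ[k] C.Hom X Y) (n : ι) (X Y : (eqSub f g T).toCocategory.Ob)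
    (t : (eqSub f g T).toCocategory.Hom X Y) :
    T n _ _ ((eqSub f g T).incl.map X Y t) ∈ LinearMap.range ((eqSub f g T).incl.map X Y) :=
  ⟨⟨_, (admissible_eqHom f g T).op_mem n _ _ t.1 t.2⟩, rfl⟩

lemma GrCocategory.Mor.ext_toCMor {C D : GrCocategory.{u, v, w} k} {f g : C.Mor D}
    (h : f.toCMor = g.toCMor) : f = g := by
  cases f; cases g; cases h; rfl

lemma DGCocategory.Mor.ext_toCMor {C D : DGCocategory.{u, v, w} k} {f g : C.Mor D}
    (h : f.toCMor = g.toCMor) : f = g := by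
  obtain ⟨f, _⟩ := f
  obtain ⟨g, _⟩ := g
  obtain rfl : f = g := GrCocategory.Mor.ext_toCMor h
  rfl

lemma AugCocategory.Mor.ext_toCMor {C D : AugCocategory.{u, v, w} k} {f g : C.Mor D}
    (h : f.toCMor = g.toCMor) : f = g := by
  cases f; cases g; cases h; rfl

lemma GrAugCocategory.Mor.ext_toCMor {C D : GrAugCocategory.{u, v, w} k} {f g : C.Mor D}
    (h : f.toCMor = g.toCMor) : f = g := by
  obtain ⟨f, _⟩ := f
  obtain ⟨g, _⟩ := g
  obtain rfl : f = g := GrCocategory.Mor.ext_toCMor h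
  rfl

lemma DGAugCocategory.Mor.ext_toCMor {C D : DGAugCocategory.{u, v, w} k} {f g : C.Mor D}
    (h : f.toCMor = g.toCMor) : f = g := by
  obtain ⟨f, _⟩ := f
  obtain ⟨g, _⟩ := g
  obtain rfl : f = g := DGCocategory.Mor.ext_toCMor h
  rfl

lemma hasEqualizers_cocomplete : HasEqualizers (CocompleteCocategory.{u, v, w} k) := by
  refine hasEqualizers_fullSubcategory _ fun {C D} hC f g => ?_
  let T : Empty → ∀ X Y, C.Hom X Y →ₗ[k] C.Hom X Y := fun e => e.elim
  refine ⟨(eqSub f g T).toCocategory, (eqSub f g T).incl, (eqSub f g T).isCocomplete hC,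
    eqSub_incl_comp f g T, fun B h hfg => ?_⟩
  have hh := eqSub_contains f g T (h := h) hfg fun e => e.elim
  exact ⟨hh.lift, hh.lift_incl, fun l hl => (eqSub f g T).incl_cancel hl⟩

lemma hasEqualizers_cocompleteGr : HasEqualizers (CocompleteGrCocategory.{u, v, w} k) := by
  refine hasEqualizers_fullSubcategory _ fun {C D} hC f g => ?_
  let F := eqSub f.toCMor g.toCMor (grOp C)
  have hproj := eqSub_op_mem_range f.toCMor g.toCMor (grOp C)
  refine ⟨C.restrict F.isEmbedding_incl hproj, C.restrictIncl F.isEmbedding_incl hproj,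
    F.isCocomplete hC, GrCocategory.Mor.ext_toCMor (eqSub_incl_comp f.toCMor g.toCMor (grOp C)),
    fun B h hfg => ?_⟩
  have hh := eqSub_contains f.toCMor g.toCMor (grOp C) (h := h.toCMor)
    (congrArg GrCocategory.Mor.toCMor hfg) h.exists_grOp_map
  -- the induced degrees are preimages of those of `C`, so the lift has degree `0` because `h` has
  exact ⟨⟨hh.lift, h.map_deg⟩, rfl, fun l hl => GrCocategory.Mor.ext_toCMor
    (F.incl_cancel (congrArg GrCocategory.Mor.toCMor hl))⟩

/-- The differential of the lift is tested after composition with the embedding. -/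
lemma DGCocategory.map_restrictD_lift (C : DGCocategory.{u, v, w} k) {E : Cocategory.{u, v, w} k}
    {i : E.Mor C.toCocategory} (hi : i.IsEmbedding)
    (hd : ∀ X Y t, C.d _ _ (i.map X Y t) ∈ LinearMap.range (i.map X Y))
    {B : DGCocategory.{u, v, w} k} (l : B.toCocategory.Mor E)
    (h : ∀ X Y, C.d _ _ ∘ₗ (l.comp i).map X Y = (l.comp i).map X Y ∘ₗ B.d X Y) (X Y : B.Ob) :
    C.restrictD hi hd (l.obj X) (l.obj Y) ∘ₗ l.map X Y = l.map X Y ∘ₗ B.d X Y :=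
  LinearMap.ext fun t => hi.map_injective _ _
    ((LinearMap.congr_fun (C.map_restrictD hi hd _ _) (l.map X Y t)).trans
      (LinearMap.congr_fun (h X Y) t))

lemma hasEqualizers_cocompleteDG : HasEqualizers (CocompleteDGCocategory.{u, v, w} k) := by
  refine hasEqualizers_fullSubcategory _ fun {C D} hC f g => ?_
  let F := eqSub f.toCMor g.toCMor (dgOp C)
  have hop := eqSub_op_mem_range f.toCMor g.toCMor (dgOp C)
  have hproj := fun n : ℤ => hop (some n)
  refine ⟨C.restrict F.isEmbedding_incl hproj (hop none),
    C.restrictIncl F.isEmbedding_incl hproj (hop none), F.isCocomplete hC,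
    DGCocategory.Mor.ext_toCMor (eqSub_incl_comp f.toCMor g.toCMor (dgOp C)), fun B h hfg => ?_⟩
  have hh := eqSub_contains f.toCMor g.toCMor (dgOp C) (h := h.toCMor)
    (congrArg (fun m : B.Mor D => m.toCMor) hfg) h.exists_dgOp_map
  exact ⟨⟨⟨hh.lift, h.map_deg⟩,
      C.map_restrictD_lift F.isEmbedding_incl (hop none) hh.lift h.map_d⟩, rfl,
    fun l hl => DGCocategory.Mor.ext_toCMor
      (F.incl_cancel (congrArg (fun m : B.Mor C => m.toCMor) hl))⟩

lemma hasEqualizers_cocompleteAug : HasEqualizers (CocompleteAugCocategory.{u, v, w} k) := by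
  refine hasEqualizers_fullSubcategory _ fun {C D} hC f g => ?_
  let T : Empty → ∀ X Y, C.Hom X Y →ₗ[k] C.Hom X Y := fun e => e.elim
  let F := eqSub f.toCMor g.toCMor T
  have hη := C.aug.η_mem_eqSub (T := T) f.compat g.compat fun e => e.elim
  refine ⟨⟨F.toCocategory, C.aug.restrict F.isEmbedding_incl hη⟩,
    ⟨F.incl, C.aug.restrict_compatible F.isEmbedding_incl hη⟩,
    C.aug.isCocomplete_restrict F.isEmbedding_incl hη hC,
    AugCocategory.Mor.ext_toCMor (eqSub_incl_comp f.toCMor g.toCMor T), fun B h hfg => ?_⟩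
  have hh := eqSub_contains f.toCMor g.toCMor T (h := h.toCMor)
    (congrArg AugCocategory.Mor.toCMor hfg) fun e => e.elim
  exact ⟨⟨hh.lift, .of_restrict C.aug F.isEmbedding_incl hη h.compat⟩, rfl,
    fun l hl => AugCocategory.Mor.ext_toCMor
      (F.incl_cancel (congrArg AugCocategory.Mor.toCMor hl))⟩

lemma hasEqualizers_cocompleteGrAug : HasEqualizers (CocompleteGrAugCocategory.{u, v, w} k) := by
  refine hasEqualizers_fullSubcategory _ fun {C D} hC f g => ?_
  let T := grOp C.toGrCocategory
  let F := eqSub f.toCMor g.toCMor T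
  have hproj := eqSub_op_mem_range f.toCMor g.toCMor T
  have hη := C.aug.η_mem_eqSub (T := T) f.compat g.compat (exists_grOp_η C.aug C.η_deg)
  have hi := F.isEmbedding_incl
  refine ⟨⟨C.toGrCocategory.restrict hi hproj, C.aug.restrict hi hη,
      fun X Y n hn t ht => Augmentation.discMap_injective (k := k) F.incl.obj X Y
        (C.ε_deg _ _ n hn _ ht),
      fun X Y c => (congrArg (· ∈ C.deg _ _ 0) (C.aug.map_restrictη hi hη X Y c)).mpr
        (C.η_deg _ _ _)⟩,
    ⟨C.toGrCocategory.restrictIncl hi hproj, C.aug.restrict_compatible hi hη⟩,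
    C.aug.isCocomplete_restrict hi hη hC,
    GrAugCocategory.Mor.ext_toCMor (eqSub_incl_comp f.toCMor g.toCMor T), fun B h hfg => ?_⟩
  have hh := eqSub_contains f.toCMor g.toCMor T (h := h.toCMor)
    (congrArg (fun m : B.Mor D => m.toCMor) hfg) h.toGrMor.exists_grOp_map
  exact ⟨⟨⟨hh.lift, h.map_deg⟩, .of_restrict C.aug hi hη h.compat⟩, rfl,
    fun l hl => GrAugCocategory.Mor.ext_toCMor
      (F.incl_cancel (congrArg (fun m : B.Mor C => m.toCMor) hl))⟩

lemma hasEqualizers_cocompleteDGAug : HasEqualizers (CocompleteDGAugCocategory.{u, v, w} k) := by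
  refine hasEqualizers_fullSubcategory _ fun {C D} hC f g => ?_
  let T := dgOp C.toDGCocategory
  let F := eqSub f.toCMor g.toCMor T
  have hop := eqSub_op_mem_range f.toCMor g.toCMor T
  have hproj := fun n : ℤ => hop (some n)
  have hη := C.aug.η_mem_eqSub (T := T) f.compat g.compat (exists_dgOp_η C.aug C.η_deg C.d_η)
  have hi := F.isEmbedding_incl
  refine ⟨⟨C.toDGCocategory.restrict hi hproj (hop none), C.aug.restrict hi hη,
      fun X Y n hn t ht => Augmentation.discMap_injective (k := k) F.incl.obj X Y
        (C.ε_deg _ _ n hn _ ht),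
      fun X Y c => (congrArg (· ∈ C.deg _ _ 0) (C.aug.map_restrictη hi hη X Y c)).mpr
        (C.η_deg _ _ _),
      fun X Y => LinearMap.ext fun t => Augmentation.discMap_injective (k := k) F.incl.obj X Y
        ((congrArg (C.aug.ε _ _)
          (LinearMap.congr_fun (C.toDGCocategory.map_restrictD hi (hop none) X Y) t)).trans
          (LinearMap.congr_fun (C.ε_d _ _) _)),
      fun X Y => LinearMap.ext fun c => hi.map_injective X Y
        ((LinearMap.congr_fun (C.toDGCocategory.map_restrictD hi (hop none) X Y) _).trans
          ((congrArg (C.d _ _) (C.aug.map_restrictη hi hη X Y c)).trans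
            ((LinearMap.congr_fun (C.d_η _ _) _).trans (map_zero _).symm)))⟩,
    ⟨C.toDGCocategory.restrictIncl hi hproj (hop none), C.aug.restrict_compatible hi hη⟩,
    C.aug.isCocomplete_restrict hi hη hC,
    DGAugCocategory.Mor.ext_toCMor (eqSub_incl_comp f.toCMor g.toCMor T), fun B h hfg => ?_⟩
  have hh := eqSub_contains f.toCMor g.toCMor T (h := h.toCMor)
    (congrArg (fun m : B.Mor D => m.toCMor) hfg) h.toDGMor.exists_dgOp_map
  exact ⟨⟨⟨⟨hh.lift, h.map_deg⟩,
      C.toDGCocategory.map_restrictD_lift hi (hop none) hh.lift h.map_d⟩,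
      .of_restrict C.aug hi hη h.compat⟩, rfl,
    fun l hl => DGAugCocategory.Mor.ext_toCMor
      (F.incl_cancel (congrArg (fun m : B.Mor C => m.toCMor) hl))⟩

end Field

end

end Cocat

theorem mainTheorem1 (k : Type u) [Field k] :
    HasEqualizers (Cocat.CocompleteCocategory.{u, v, w} k) ∧
    HasEqualizers (Cocat.CocompleteGrCocategory.{u, v, w} k) ∧
    HasEqualizers (Cocat.CocompleteDGCocategory.{u, v, w} k) ∧
    HasEqualizers (Cocat.CocompleteAugCocategory.{u, v, w} k) ∧
    HasEqualizers (Cocat.CocompleteGrAugCocategory.{u, v, w} k) ∧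
    HasEqualizers (Cocat.CocompleteDGAugCocategory.{u, v, w} k) :=
  ⟨Cocat.hasEqualizers_cocomplete, Cocat.hasEqualizers_cocompleteGr,
    Cocat.hasEqualizers_cocompleteDG, Cocat.hasEqualizers_cocompleteAug,
    Cocat.hasEqualizers_cocompleteGrAug, Cocat.hasEqualizers_cocompleteDGAug⟩
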